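/- \textbf{Notation.} For a bounded open convex set $\Omega\subset\mathbb R^2$ let $|\Omega|$ be its Lebesgue measure, $P(\Omega)$ its perimeter (the length of $\partial\Omega$), and $R_\Omega$ its inradius (the supremum of the radii of the balls contained in $\Omega$). For $p>1$ let $u_p\in W^{1,p}_0(\Omega)$ be the $p$-torsion function of $\Omega$, i.e. the unique weak solution of $-\operatorname{div}(|\nabla u|^{p-2}\nabla u)=1$ in $\Omega$, $u=0$ on $\partial\Omega$, and set \[ T_p(\Omega):=\int_\Omega u_p\,dx,\qquad T(p;\Omega):=|\Omega|^{p-1}\,T_p(\Omega)^{1-p},\qquad Q_p(\Omega):=\left(\frac{T(p;\Omega)\,R_\Omega^{\,p}}{\big(\frac{2p-1}{p-1}\big)^{p-1}}\right)^{1/p}. \] Let $\mathcal T$ be the family of all open bounded nondegenerate triangles in $\mathbb R^2$, and put \[ \gamma_{\mathcal T}(p):=\frac{\inf_{T\in\mathcal T}Q_p(T)}{\sup_{T\in\mathcal T}Q_p(T)} . \] \textbf{Proposition.} Let $p>1$. For every $T\in\mathcal T$ one has \[ \frac{R_T\,P(T)}{|T|}=2\qquad\text{and}\qquad 1\le Q_p(T)<2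 . \] Hence $\gamma_{\mathcal T}(p)\ge \tfrac12$. -/

import Mathlib

open MeasureTheory Set Filter Topology
open scoped ContDiff ENNReal Gradient

noncomputable section

namespace PTorsion

/-- Test functions: the class of smooth functions with compact support contained in `Ω`. -/
structure IsTestFunction {D : ℕ} (Ω : Set (EuclideanSpace ℝ (Fin D)))
    (φ : EuclideanSpace ℝ (Fin D) → ℝ) : Prop where
  smooth : ContDiff ℝ ∞ φ
  compact : HasCompactSupport φ
  support_subset : tsupport φ ⊆ Ω

/-- `G` is the weak (distributional) gradient of `u` on `Ω`
(used below for `u` and `G` in some `L^p(Ω)`). -/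
def IsWeakGradient {D : ℕ} (Ω : Set (EuclideanSpace ℝ (Fin D)))
    (u : EuclideanSpace ℝ (Fin D) → ℝ)
    (G : EuclideanSpace ℝ (Fin D) → EuclideanSpace ℝ (Fin D)) : Prop :=
  ∀ φ : EuclideanSpace ℝ (Fin D) → ℝ, IsTestFunction Ω φ →
    ∫ x in Ω, u x • ∇ φ x = - ∫ x in Ω, φ x • G x

/-- `u` belongs to the Sobolev space `W^{1,p}(Ω)`, with weak gradient `G`. -/
structure MemW1 {D : ℕ} (p : ℝ) (Ω : Set (EuclideanSpace ℝ (Fin D)))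
    (u : EuclideanSpace ℝ (Fin D) → ℝ)
    (G : EuclideanSpace ℝ (Fin D) → EuclideanSpace ℝ (Fin D)) : Prop where
  memLp : MemLp u (ENNReal.ofReal p) (volume.restrict Ω)
  memLp_grad : MemLp G (ENNReal.ofReal p) (volume.restrict Ω)
  weakGradient : IsWeakGradient Ω u G

/-- `u` belongs to `W_0^{1,p}(Ω)`, the closure of the test functions in `W^{1,p}(Ω)`,
and `G` is its weak gradient. -/
structure MemW10 {D : ℕ} (p : ℝ) (Ω : Set (EuclideanSpace ℝ (Fin D)))
    (u : EuclideanSpace ℝ (Fin D) → ℝ)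
    (G : EuclideanSpace ℝ (Fin D) → EuclideanSpace ℝ (Fin D)) : Prop
    extends MemW1 p Ω u G where
  approx : ∃ φ : ℕ → EuclideanSpace ℝ (Fin D) → ℝ,
    (∀ n, IsTestFunction Ω (φ n)) ∧
    Tendsto (fun n => eLpNorm (fun x => φ n x - u x) (ENNReal.ofReal p) (volume.restrict Ω))
      atTop (𝓝 0) ∧
    Tendsto (fun n => eLpNorm (fun x => ∇ (φ n) x - G x) (ENNReal.ofReal p) (volume.restrict Ω))
      atTop (𝓝 0)

/-- `u` is a `p`-torsion function on `Ω`: a weak solution in `W_0^{1,p}(Ω)` of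
`-div (|∇u|^{p-2} ∇u) = 1` in `Ω`, `u = 0` on `∂Ω`.
(Where `G x = 0` the field `‖G x‖ ^ (p - 2) • G x` is `0`, as it should be.) -/
def IsTorsionFunction {D : ℕ} (p : ℝ) (Ω : Set (EuclideanSpace ℝ (Fin D)))
    (u : EuclideanSpace ℝ (Fin D) → ℝ) : Prop :=
  ∃ G : EuclideanSpace ℝ (Fin D) → EuclideanSpace ℝ (Fin D), MemW10 p Ω u G ∧
    ∀ φ : EuclideanSpace ℝ (Fin D) → ℝ, IsTestFunction Ω φ →
      ∫ x in Ω, inner ℝ (‖G x‖ ^ (p - 2) • G x) (∇ φ x) = ∫ x in Ω, φ x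

open Classical in
/-- The `p`-torsional rigidity `T_p(Ω) = ∫_Ω u_p`, where `u_p` is the `p`-torsion function of `Ω`.
For a bounded open convex `Ω` and `p > 1` the torsion function exists and is unique up to
equality almost everywhere on `Ω`, so the choice does not affect the integral; the value `0`
is a placeholder for the case that there is none. -/
def torsionalRigidity {D : ℕ} (p : ℝ) (Ω : Set (EuclideanSpace ℝ (Fin D))) : ℝ :=
  if h : ∃ u, IsTorsionFunction p Ω u then ∫ x in Ω, h.choose x else 0

/-- The normalized rigidity `T(p;Ω) = |Ω|^{p-1} T_p(Ω)^{1-p}`. -/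
def normalizedRigidity {D : ℕ} (p : ℝ) (Ω : Set (EuclideanSpace ℝ (Fin D))) : ℝ :=
  (volume.real Ω) ^ (p - 1) * torsionalRigidity p Ω ^ (1 - p)

/-- The inradius `R_Ω`: the supremum of the radii of the balls contained in `Ω`. -/
def inradius {D : ℕ} (Ω : Set (EuclideanSpace ℝ (Fin D))) : ℝ :=
  sSup {r : ℝ | 0 ≤ r ∧ ∃ c, Metric.ball c r ⊆ Ω}

/-- The scale-invariant functional
`Q_p(Ω) = (T(p;Ω) R_Ω^p / ((2p-1)/(p-1))^{p-1})^{1/p}`. -/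
def Q {D : ℕ} (p : ℝ) (Ω : Set (EuclideanSpace ℝ (Fin D))) : ℝ :=
  (normalizedRigidity p Ω * inradius Ω ^ p / ((2 * p - 1) / (p - 1)) ^ (p - 1)) ^ (1 / p)

/-- `α_𝓕(p) = inf_{Ω ∈ 𝓕} Q_p(Ω)`. -/
def alpha {D : ℕ} (F : Set (Set (EuclideanSpace ℝ (Fin D)))) (p : ℝ) : ℝ :=
  sInf (Q p '' F)

/-- `β_𝓕(p) = sup_{Ω ∈ 𝓕} Q_p(Ω)`. -/
def beta {D : ℕ} (F : Set (Set (EuclideanSpace ℝ (Fin D)))) (p : ℝ) : ℝ :=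
  sSup (Q p '' F)

/-- `γ_𝓕(p) = α_𝓕(p) / β_𝓕(p)`. -/
def gamma {D : ℕ} (F : Set (Set (EuclideanSpace ℝ (Fin D)))) (p : ℝ) : ℝ :=
  alpha F p / beta F p

/-- The perimeter of a planar domain: the length (one-dimensional Hausdorff measure)
of its boundary. -/
def perimeter (Ω : Set (EuclideanSpace ℝ (Fin 2))) : ℝ :=
  (Measure.hausdorffMeasure 1 : Measure (EuclideanSpace ℝ (Fin 2))).real (frontier Ω)

/-- The family of all (open, bounded, nondegenerate) triangles in the plane. -/
def triangles : Set (Set (EuclideanSpace ℝ (Fin 2))) :=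
  {Ω | ∃ a b c : EuclideanSpace ℝ (Fin 2), AffineIndependent ℝ ![a, b, c] ∧
    Ω = interior (convexHull ℝ {a, b, c})}

end PTorsion

end

open MeasureTheory Set Filter Topology
open scoped ContDiff ENNReal Gradient

noncomputable section

/-! A triangle is circumscribed about its incircle: with incentre `c`, inradius `R` and outer unit
normals `n i` it is the set where every `⟨n i, x - c⟩` is less than `R`. The incentre and radius are
explicit in terms of side lengths and area, `R` being twice the area over the perimeter, which is
the first identity. The bounds on `Q` use only circumscription. Put `q = p / (p - 1)`, so that `(2p
- 1) / (p - 1) = q + 1`, and let `V` be the area and `I` the torsional rigidity.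

`1 ≤ Q` is the upper bound `I ≤ R ^ q * V / (q + 1)` (`IsCircumscribed.integral_torsion_le`). Cut
`T` into the regions of points nearest to each side. Over its side such a region is a subgraph of
height at most `R`. Integrating a test function by parts along the inner normal, followed by Hölder
on each region and for the sum over sides, gives a Hersch–Makai inequality, which passes to the
torsion function.

`Q < 2` is a lower bound for `I` (`IsCircumscribed.le_integral_torsion`), from the Rayleigh quotient
of `1 - g ^ q`, where `g` is the gauge of `T` about `c`. It has Lipschitz constant `1 / R`, and
homothety gives `∫ g ^ q = 2V / (q + 2)`. The outcome is `Q ^ p ≤ 2 * ((q + 2) / (q + 1)) ^ (p -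
1)`, which is less than `2 ^ p` since `q + 2 < 2 * (q + 1)`.

The rigidity is defined by choice with default `0`, so a torsion function has to be shown to exist.
It is the limit of a minimising sequence of the energy, Cauchy by uniform convexity. Uniqueness is
not needed: both bounds hold for every torsion function, through the energy identity `∫ ‖G‖ ^ p = ∫
u`. -/

namespace PTorsion

/-! ### Uniform convexity of the `p`-th power of a Euclidean norm -/

section UniformConvexity

variable {F : Type*} [NormedAddCommGroup F] [InnerProductSpace ℝ F]

/-- For equal norms this is strict convexity of the inner product norm; for different norms it is
strict convexity of `t ↦ t ^ p`. -/
theorem norm_midpoint_rpow_lt {p : ℝ} (hp : 1 < p) {a b : F} (hab : a ≠ b) :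
    ‖(1 / 2 : ℝ) • (a + b)‖ ^ p < (‖a‖ ^ p + ‖b‖ ^ p) / 2 := by
  have hp0 : 0 < p := by linarith
  by_cases h : ‖a‖ = ‖b‖
  · have h1 : ‖(1 / 2 : ℝ) • (a + b)‖ < ‖a‖ := (norm_midpoint_lt_iff h).2 hab
    have := Real.rpow_lt_rpow (norm_nonneg _) h1 hp0
    rw [← h]; linarith
  · have h1 : ‖(1 / 2 : ℝ) • (a + b)‖ ≤ (1 / 2 : ℝ) • ‖a‖ + (1 / 2 : ℝ) • ‖b‖ := by
      rw [norm_smul, smul_eq_mul, smul_eq_mul]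
      have := norm_add_le a b
      norm_num
      linarith
    have h2 := (strictConvexOn_rpow hp).2 (norm_nonneg a) (norm_nonneg b) h
      (by norm_num : (0 : ℝ) < 1 / 2) (by norm_num : (0 : ℝ) < 1 / 2) (by norm_num)
    have h3 := Real.rpow_le_rpow (norm_nonneg _) h1 hp0.le
    simp only [smul_eq_mul] at h2 h3
    linarith

theorem norm_midpoint_rpow_le {p : ℝ} (hp : 1 < p) (a b : F) :
    ‖(1 / 2 : ℝ) • (a + b)‖ ^ p ≤ (‖a‖ ^ p + ‖b‖ ^ p) / 2 := by
  by_cases hab : a = b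
  · subst hab
    rw [← two_smul ℝ a, smul_smul]
    norm_num
  · exact (norm_midpoint_rpow_lt hp hab).le

/-- Uniform convexity of `‖·‖ ^ p` in a finite-dimensional inner product space. -/
theorem exists_norm_sub_rpow_le [FiniteDimensional ℝ F] {p : ℝ} (hp : 1 < p) {ε : ℝ}
    (hε : 0 < ε) : ∃ C : ℝ, 0 ≤ C ∧ ∀ a b : F,
      ‖a - b‖ ^ p ≤ ε * (‖a‖ ^ p + ‖b‖ ^ p) +
        C * ((‖a‖ ^ p + ‖b‖ ^ p) / 2 - ‖(1 / 2 : ℝ) • (a + b)‖ ^ p) := by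
  have hp0 : 0 < p := by linarith
  have hcont : ∀ g : F × F → F, Continuous g → Continuous fun z => ‖g z‖ ^ p := fun g hg =>
    hg.norm.rpow_const fun _ => Or.inr hp0.le
  have c1 : Continuous fun z : F × F => ‖z.1‖ ^ p := hcont _ continuous_fst
  have c2 : Continuous fun z : F × F => ‖z.2‖ ^ p := hcont _ continuous_snd
  have c3 : Continuous fun z : F × F => ‖z.1 - z.2‖ ^ p := hcont _ (by fun_prop)
  have c4 : Continuous fun z : F × F => ‖(1 / 2 : ℝ) • (z.1 + z.2)‖ ^ p := hcont _ (by fun_prop)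
  -- On this compact set the convexity defect is positive, hence at least some `m > 0`, while `‖a -
  -- b‖ ^ p` has a maximum `B`; `C = B / m` then works. Off it the `ε` term alone suffices.
  set K : Set (F × F) := {z | ‖z.1‖ ^ p + ‖z.2‖ ^ p = 1 ∧ ε ≤ ‖z.1 - z.2‖ ^ p} with hK
  have hKc : IsCompact K := by
    refine Metric.isCompact_of_isClosed_isBounded ?_ ?_
    · exact (isClosed_eq (c1.add c2) continuous_const).inter (isClosed_le continuous_const c3)
    · refine (Metric.isBounded_closedBall (x := (0 : F × F)) (r := 1)).subset ?_
      rintro ⟨a, b⟩ ⟨h1, -⟩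
      simp only at h1
      have ha : ‖a‖ ^ p ≤ 1 := by linarith [Real.rpow_nonneg (norm_nonneg b) p]
      have hb : ‖b‖ ^ p ≤ 1 := by linarith [Real.rpow_nonneg (norm_nonneg a) p]
      rw [mem_closedBall_zero_iff, Prod.norm_def]
      exact max_le (le_of_not_gt fun h => ha.not_gt (Real.one_lt_rpow h hp0))
        (le_of_not_gt fun h => hb.not_gt (Real.one_lt_rpow h hp0))
  have hunit : ∃ C : ℝ, 0 ≤ C ∧ ∀ a b : F, ‖a‖ ^ p + ‖b‖ ^ p = 1 →
      ‖a - b‖ ^ p ≤ ε + C * (1 / 2 - ‖(1 / 2 : ℝ) • (a + b)‖ ^ p) := by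
    have hnn : ∀ a b : F, ‖a‖ ^ p + ‖b‖ ^ p = 1 → 0 ≤ 1 / 2 - ‖(1 / 2 : ℝ) • (a + b)‖ ^ p := by
      intro a b h
      have := norm_midpoint_rpow_le hp a b
      rw [h] at this
      linarith
    rcases K.eq_empty_or_nonempty with he | hne
    · refine ⟨0, le_rfl, fun a b h => ?_⟩
      by_contra! hc
      have : (a, b) ∈ K := ⟨h, by simp only; linarith⟩
      simp [he] at this
    · obtain ⟨z, hz, hmin⟩ := hKc.exists_isMinOn hne
        (f := fun z : F × F => 1 / 2 - ‖(1 / 2 : ℝ) • (z.1 + z.2)‖ ^ p)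
        (continuous_const.sub c4).continuousOn
      obtain ⟨w, hw, hmax⟩ := hKc.exists_isMaxOn hne (f := fun z : F × F => ‖z.1 - z.2‖ ^ p)
        c3.continuousOn
      set m := 1 / 2 - ‖(1 / 2 : ℝ) • (z.1 + z.2)‖ ^ p with hm
      have hmpos : 0 < m := by
        have hzne : z.1 ≠ z.2 := by
          intro h
          have := hz.2
          rw [h, sub_self, norm_zero, Real.zero_rpow hp0.ne'] at this
          linarith
        have := norm_midpoint_rpow_lt hp hzne
        rw [hz.1] at this
        linarith
      set B := ‖w.1 - w.2‖ ^ p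
      have hB : 0 ≤ B := Real.rpow_nonneg (norm_nonneg _) _
      refine ⟨B / m, by positivity, fun a b h => ?_⟩
      by_cases hc : ε ≤ ‖a - b‖ ^ p
      · have hab : (a, b) ∈ K := ⟨h, hc⟩
        have h1 : m ≤ 1 / 2 - ‖(1 / 2 : ℝ) • (a + b)‖ ^ p := hmin hab
        have h2 : ‖a - b‖ ^ p ≤ B := hmax hab
        have h3 : B ≤ B / m * (1 / 2 - ‖(1 / 2 : ℝ) • (a + b)‖ ^ p) := by
          calc B = B / m * m := by field_simp
            _ ≤ _ := by gcongr
        linarith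
      · have := mul_nonneg (show 0 ≤ B / m by positivity) (hnn a b h)
        linarith
  obtain ⟨C, hC, hU⟩ := hunit
  refine ⟨C, hC, fun a b => ?_⟩
  set f := ‖a‖ ^ p + ‖b‖ ^ p with hf
  have ha := Real.rpow_nonneg (norm_nonneg a) p
  have hb := Real.rpow_nonneg (norm_nonneg b) p
  rcases (by positivity : 0 ≤ f).eq_or_lt with h0 | hpos
  · have ha0 : ‖a‖ ^ p = 0 := by linarith
    have hb0 : ‖b‖ ^ p = 0 := by linarith
    have ha' := (Real.rpow_eq_zero (norm_nonneg a) hp0.ne').1 ha0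
    have hb' := (Real.rpow_eq_zero (norm_nonneg b) hp0.ne').1 hb0
    rw [norm_eq_zero] at ha' hb'
    simp [← h0, ha', hb', Real.zero_rpow hp0.ne']
  -- Both sides are homogeneous of degree `p`, so the pair may be rescaled to `‖a‖ ^ p + ‖b‖ ^ p =
  -- 1`.
  · set r := f ^ (1 / p) with hr
    have hrpos : 0 < r := Real.rpow_pos_of_pos hpos _
    have hrp : r ^ p = f := by rw [hr, ← Real.rpow_mul hpos.le]; field_simp; simp
    have key : ∀ v : F, ‖r⁻¹ • v‖ ^ p = ‖v‖ ^ p / f := by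
      intro v
      rw [norm_smul, Real.norm_of_nonneg (by positivity), Real.mul_rpow (by positivity)
        (norm_nonneg _), Real.inv_rpow hrpos.le, hrp]
      field_simp
    have := hU (r⁻¹ • a) (r⁻¹ • b) (by rw [key, key, ← add_div, ← hf]; field_simp)
    rw [← smul_sub, ← smul_add, smul_comm, key, key, div_le_iff₀ hpos] at this
    refine this.trans (le_of_eq ?_)
    field_simp

end UniformConvexity

/-! ### Algebra and integrability of test functions -/

section TestFunctions

variable {D : ℕ} {Ω : Set (EuclideanSpace ℝ (Fin D))} {φ ψ : EuclideanSpace ℝ (Fin D) → ℝ}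

theorem IsTestFunction.differentiable (h : IsTestFunction Ω φ) : Differentiable ℝ φ :=
  h.smooth.differentiable (by simp)

theorem IsTestFunction.continuous (h : IsTestFunction Ω φ) : Continuous φ :=
  h.smooth.continuous

theorem IsTestFunction.zero : IsTestFunction Ω 0 :=
  ⟨contDiff_const, HasCompactSupport.zero, by simp [tsupport]⟩

theorem IsTestFunction.add (h : IsTestFunction Ω φ) (h' : IsTestFunction Ω ψ) :
    IsTestFunction Ω (φ + ψ) :=
  ⟨h.smooth.add h'.smooth, h.compact.add h'.compact,
    (tsupport_add φ ψ).trans (union_subset h.support_subset h'.support_subset)⟩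

theorem IsTestFunction.smul (c : ℝ) (h : IsTestFunction Ω φ) : IsTestFunction Ω (c • φ) :=
  ⟨h.smooth.const_smul c, h.compact.smul_left,
    (tsupport_smul_subset_right (fun _ => c) φ).trans h.support_subset⟩

theorem IsTestFunction.gradient_add (h : IsTestFunction Ω φ) (h' : IsTestFunction Ω ψ) :
    ∇ (φ + ψ) = ∇ φ + ∇ ψ := by
  ext1 x
  simp [gradient, fderiv_add (h.differentiable x) (h'.differentiable x)]

theorem IsTestFunction.gradient_smul (c : ℝ) (h : IsTestFunction Ω φ) :
    ∇ (c • φ) = c • ∇ φ := by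
  ext1 x
  simp [gradient, fderiv_const_smul (h.differentiable x)]

theorem IsTestFunction.continuous_gradient (h : IsTestFunction Ω φ) : Continuous (∇ φ) :=
  (LinearIsometryEquiv.continuous _).comp (h.smooth.continuous_fderiv (by simp))

theorem gradient_eq_zero_of_notMem_tsupport {x : EuclideanSpace ℝ (Fin D)}
    (hx : x ∉ tsupport φ) : ∇ φ x = 0 := by
  have : fderiv ℝ φ x = 0 := by
    by_contra h
    exact hx (support_fderiv_subset ℝ h)
  simp [gradient, this]

theorem IsTestFunction.hasCompactSupport_gradient (h : IsTestFunction Ω φ) :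
    HasCompactSupport (∇ φ) :=
  HasCompactSupport.intro h.compact fun _ hx => gradient_eq_zero_of_notMem_tsupport hx

theorem IsTestFunction.eq_zero (h : IsTestFunction Ω φ) {x : EuclideanSpace ℝ (Fin D)}
    (hx : x ∉ Ω) : φ x = 0 :=
  image_eq_zero_of_notMem_tsupport fun hx' => hx (h.support_subset hx')

theorem IsTestFunction.memLp (h : IsTestFunction Ω φ) (q : ℝ≥0∞) :
    MemLp φ q (volume.restrict Ω) :=
  (h.continuous.memLp_of_hasCompactSupport h.compact).restrict Ω

theorem IsTestFunction.memLp_gradient (h : IsTestFunction Ω φ) (q : ℝ≥0∞) :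
    MemLp (∇ φ) q (volume.restrict Ω) :=
  (h.continuous_gradient.memLp_of_hasCompactSupport h.hasCompactSupport_gradient).restrict Ω

end TestFunctions

/-! ### Hölder estimates in `L^p` -/

section Lp

variable {α : Type*} [MeasurableSpace α] {μ : Measure α} {F : Type*} [NormedAddCommGroup F]
  {p : ℝ}

theorem integral_norm_rpow_eq (hp : 1 < p) {f : α → F} (hf : MemLp f (ENNReal.ofReal p) μ) :
    ∫ x, ‖f x‖ ^ p ∂μ = ‖hf.toLp f‖ ^ p := by
  have hp0 : 0 < p := by linarith
  have hI : 0 ≤ ∫ x, ‖f x‖ ^ p ∂μ := integral_nonneg fun x => Real.rpow_nonneg (norm_nonneg _) _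
  rw [Lp.norm_toLp, hf.eLpNorm_eq_integral_rpow_norm (by simpa using hp0) (by simp),
    ENNReal.toReal_ofReal hp0.le, ENNReal.toReal_ofReal (by positivity),
    ← Real.rpow_mul hI, inv_mul_cancel₀ hp0.ne', Real.rpow_one]

theorem integrable_norm_rpow (hp : 1 < p) {f : α → F} (hf : MemLp f (ENNReal.ofReal p) μ) :
    Integrable (fun x => ‖f x‖ ^ p) μ := by
  have hp0 : 0 < p := by linarith
  simpa [ENNReal.toReal_ofReal hp0.le] using
    hf.integrable_norm_rpow (by simpa using hp0) (by simp)

theorem memLp_norm_rpow_sub_one (hp : 1 < p) {f : α → F} (hf : MemLp f (ENNReal.ofReal p) μ) :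
    MemLp (fun x => ‖f x‖ ^ (p - 1)) (ENNReal.ofReal (p.conjExponent)) μ := by
  have hp0 : 0 < p := by linarith
  have h1 : 0 < p - 1 := by linarith
  have := hf.norm_rpow_div (ENNReal.ofReal (p - 1))
  rwa [ENNReal.toReal_ofReal h1.le, ← ENNReal.ofReal_div_of_pos h1] at this

/-- Hölder's inequality in the form used for the `p`-Laplacian. -/
theorem integral_norm_rpow_sub_one_mul_le (hp : 1 < p) {f : α → F} {F' : Type*}
    [NormedAddCommGroup F'] {g : α → F'} (hf : MemLp f (ENNReal.ofReal p) μ)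
    (hg : MemLp g (ENNReal.ofReal p) μ) :
    Integrable (fun x => ‖f x‖ ^ (p - 1) * ‖g x‖) μ ∧
    ∫ x, ‖f x‖ ^ (p - 1) * ‖g x‖ ∂μ ≤
      (∫ x, ‖f x‖ ^ p ∂μ) ^ (1 - 1 / p) * (∫ x, ‖g x‖ ^ p ∂μ) ^ (1 / p) := by
  have hp0 : 0 < p := by linarith
  have h1 : 0 < p - 1 := by linarith
  have hc := Real.HolderConjugate.conjExponent hp
  have hm := memLp_norm_rpow_sub_one hp hf
  constructor
  · have : ENNReal.HolderTriple (ENNReal.ofReal p.conjExponent) (ENNReal.ofReal p) 1 := by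
      have := hc.symm.ennrealOfReal
      exact this
    exact hm.integrable_mul hg.norm
  have := integral_mul_norm_le_Lp_mul_Lq hc.symm hm hg.norm
  have e1 : ∀ x, ‖‖f x‖ ^ (p - 1)‖ = ‖f x‖ ^ (p - 1) := fun x =>
    Real.norm_of_nonneg (Real.rpow_nonneg (norm_nonneg _) _)
  have e2 : ∀ x, (‖f x‖ ^ (p - 1)) ^ p.conjExponent = ‖f x‖ ^ p := fun x => by
    rw [← Real.rpow_mul (norm_nonneg _), Real.conjExponent]
    field_simp
  have e3 : 1 / p.conjExponent = 1 - 1 / p := by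
    rw [Real.conjExponent]; field_simp
  simp only [e1, e2, e3, norm_norm] at this
  exact this

end Lp

/-! ### Poincaré inequality in a strip -/

section Poincare

variable {D : ℕ} {Ω : Set (EuclideanSpace ℝ (Fin D))} {p : ℝ}

/-- Divide by `X ^ (1 - 1 / p)` and raise to the power `p`. -/
theorem le_rpow_mul_of_le_mul_rpow {p : ℝ} (hp : 1 < p) {A X Y : ℝ} (hA : 0 ≤ A) (hX0 : 0 ≤ X)
    (hY0 : 0 ≤ Y) (key : X ≤ A * (X ^ (1 - 1 / p) * Y ^ (1 / p))) : X ≤ A ^ p * Y := by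
  have hp0 : 0 < p := by linarith
  rcases hX0.eq_or_lt with h0 | hpos
  · rw [← h0]; positivity
  · have h1 : X ^ (1 / p) ≤ A * Y ^ (1 / p) := by
      have h2 : X ^ (1 - 1 / p) * X ^ (1 / p) = X := by
        rw [← Real.rpow_add hpos]; simp
      have h3 : 0 < X ^ (1 - 1 / p) := Real.rpow_pos_of_pos hpos _
      refine le_of_mul_le_mul_left ?_ h3
      rw [h2]
      linarith
    have h4 := Real.rpow_le_rpow (by positivity) h1 hp0.le
    rwa [Real.mul_rpow hA (by positivity), ← Real.rpow_mul hX0, ← Real.rpow_mul hY0,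
      one_div_mul_cancel hp0.ne', Real.rpow_one, Real.rpow_one] at h4

/-- Poincaré inequality for test functions on a set bounded in the direction `e`. -/
theorem IsTestFunction.poincare (hp : 1 < p) {e : EuclideanSpace ℝ (Fin D)} (he : ‖e‖ = 1) {M : ℝ}
    (hM : ∀ x ∈ Ω, |inner ℝ e x| ≤ M) {φ : EuclideanSpace ℝ (Fin D) → ℝ}
    (hφ : IsTestFunction Ω φ) :
    ∫ x in Ω, ‖φ x‖ ^ p ≤ (p * M) ^ p * ∫ x in Ω, ‖∇ φ x‖ ^ p := by
  have hp0 : 0 < p := by linarith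
  have hp1 : 0 < p - 1 := by linarith
  rcases Ω.eq_empty_or_nonempty with rfl | ⟨x₀, hx₀⟩
  · simp
  have hM0 : 0 ≤ M := (abs_nonneg _).trans (hM x₀ hx₀)
  have hΨ : ContDiff ℝ 1 fun x => ‖φ x‖ ^ p := (hφ.smooth.of_le (by simp)).norm_rpow hp
  have hΨs : HasCompactSupport fun x => ‖φ x‖ ^ p :=
    HasCompactSupport.intro hφ.compact fun x hx => by
      simp [image_eq_zero_of_notMem_tsupport hx, Real.zero_rpow hp0.ne']
  have hΨd : Differentiable ℝ fun x => ‖φ x‖ ^ p := hΨ.differentiable (by simp)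
  have hl : ∀ x, fderiv ℝ (fun x => inner ℝ e x) x = innerSL ℝ e := fun x =>
    (innerSL ℝ e).fderiv
  have hee : inner ℝ e e = (1 : ℝ) := by rw [real_inner_self_eq_norm_sq, he]; norm_num
  have hΨc : Continuous fun x => fderiv ℝ (fun x => ‖φ x‖ ^ p) x e :=
    (hΨ.continuous_fderiv (by simp)).clm_apply continuous_const
  have hΨcs : HasCompactSupport fun x => fderiv ℝ (fun x => ‖φ x‖ ^ p) x e :=
    hΨs.fderiv_apply ℝ e
  -- The linear function `⟨e, x⟩` has derivative `1` along `e`, so the integral of `‖φ‖ ^ p` is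
  -- minus that of `⟨e, x⟩` times the derivative of `‖φ‖ ^ p` along `e`.
  have ibp := integral_mul_fderiv_eq_neg_fderiv_mul_of_integrable (μ := volume)
    (f := fun x : EuclideanSpace ℝ (Fin D) => inner ℝ e x) (g := fun x => ‖φ x‖ ^ p) (v := e)
    (by
      simp only [hl, innerSL_apply_apply, hee, one_mul]
      exact hΨ.continuous.integrable_of_hasCompactSupport hΨs)
    ((by fun_prop : Continuous fun x : EuclideanSpace ℝ (Fin D) => inner ℝ e x).mul hΨc
      |>.integrable_of_hasCompactSupport hΨcs.mul_left)
    ((by fun_prop : Continuous fun x : EuclideanSpace ℝ (Fin D) => inner ℝ e x).mul hΨ.continuous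
      |>.integrable_of_hasCompactSupport hΨs.mul_left)
    (fun x _ => (innerSL ℝ e).differentiableAt) (fun x _ => hΨd x)
  simp only [hl, innerSL_apply_apply, hee, one_mul] at ibp
  have hb : ∀ x, |fderiv ℝ (fun x => ‖φ x‖ ^ p) x e| ≤ p * (‖φ x‖ ^ (p - 1) * ‖∇ φ x‖) := by
    intro x
    have h1 := norm_fderiv_norm_rpow_le hφ.differentiable (x := x) hp
    have h2 : ‖fderiv ℝ φ x‖ = ‖∇ φ x‖ := by simp [gradient]
    have h3 := (fderiv ℝ (fun x => ‖φ x‖ ^ p) x).le_opNorm e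
    rw [he, mul_one, Real.norm_eq_abs] at h3
    rw [h2] at h1
    linarith
  obtain ⟨hHi, hH⟩ := integral_norm_rpow_sub_one_mul_le hp (hφ.memLp (ENNReal.ofReal p))
    (hφ.memLp_gradient (ENNReal.ofReal p))
  have e1 : ∫ x, ‖φ x‖ ^ p = ∫ x in Ω, ‖φ x‖ ^ p :=
    (setIntegral_eq_integral_of_forall_compl_eq_zero fun x hx => by
      simp [hφ.eq_zero hx, Real.zero_rpow hp0.ne']).symm
  have e2 : ∫ x in Ω, inner ℝ e x * fderiv ℝ (fun x => ‖φ x‖ ^ p) x e =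
      ∫ x, inner ℝ e x * fderiv ℝ (fun x => ‖φ x‖ ^ p) x e :=
    setIntegral_eq_integral_of_forall_compl_eq_zero fun x hx => by
      have h1 := hb x
      rw [hφ.eq_zero hx, norm_zero, Real.zero_rpow hp1.ne', zero_mul, mul_zero] at h1
      rw [abs_nonpos_iff.1 h1, mul_zero]
  set X := ∫ x in Ω, ‖φ x‖ ^ p with hX
  set Y := ∫ x in Ω, ‖∇ φ x‖ ^ p with hY
  have hX0 : 0 ≤ X := integral_nonneg fun x => Real.rpow_nonneg (norm_nonneg _) _
  have hY0 : 0 ≤ Y := integral_nonneg fun x => Real.rpow_nonneg (norm_nonneg _) _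
  have hsupp : ∀ x, |inner ℝ e x * fderiv ℝ (fun x => ‖φ x‖ ^ p) x e| ≤
      M * p * (‖φ x‖ ^ (p - 1) * ‖∇ φ x‖) := by
    intro x
    by_cases hx : x ∈ Ω
    · rw [abs_mul, mul_assoc]
      exact mul_le_mul (hM x hx) (hb x) (abs_nonneg _) hM0
    · have h1 := hb x
      rw [hφ.eq_zero hx, norm_zero, Real.zero_rpow hp1.ne', zero_mul, mul_zero] at h1
      rw [abs_nonpos_iff.1 h1, mul_zero, abs_zero]
      positivity
  have key : X ≤ M * p * (X ^ (1 - 1 / p) * Y ^ (1 / p)) := by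
    calc X = -∫ x in Ω, inner ℝ e x * fderiv ℝ (fun x => ‖φ x‖ ^ p) x e := by
          rw [e2, ibp, e1, neg_neg]
      _ ≤ |∫ x in Ω, inner ℝ e x * fderiv ℝ (fun x => ‖φ x‖ ^ p) x e| := neg_le_abs _
      _ ≤ ∫ x in Ω, M * p * (‖φ x‖ ^ (p - 1) * ‖∇ φ x‖) :=
          norm_integral_le_of_norm_le (f := fun x => inner ℝ e x * fderiv ℝ (fun x => ‖φ x‖ ^ p) x e)
            (hHi.const_mul _) (.of_forall hsupp)
      _ ≤ _ := by
          rw [integral_const_mul]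
          gcongr
  rw [mul_comm p M]
  exact le_rpow_mul_of_le_mul_rpow hp (by positivity) hX0 hY0 key

end Poincare

/-! ### The torsion energy: coercivity and convexity -/

section Energy

variable {D : ℕ} {Ω : Set (EuclideanSpace ℝ (Fin D))} {p : ℝ}

/-- The `p`-torsion energy of a test function. -/
def energy (p : ℝ) (Ω : Set (EuclideanSpace ℝ (Fin D))) (φ : EuclideanSpace ℝ (Fin D) → ℝ) : ℝ :=
  (∫ x in Ω, ‖∇ φ x‖ ^ p) / p - ∫ x in Ω, φ x

theorem abs_integral_le_rpow {α : Type*} [MeasurableSpace α] {μ : Measure α} [IsFiniteMeasure μ]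
    (hp : 1 < p) {f : α → ℝ} (hf : MemLp f (ENNReal.ofReal p) μ) :
    |∫ x, f x ∂μ| ≤ (μ.real univ) ^ (1 - 1 / p) * (∫ x, ‖f x‖ ^ p ∂μ) ^ (1 / p) := by
  have h := (integral_norm_rpow_sub_one_mul_le hp (memLp_const (1 : ℝ)) hf).2
  simp only [norm_one, Real.one_rpow, one_mul, integral_const, smul_eq_mul, mul_one] at h
  exact (norm_integral_le_integral_norm f).trans h

/-- Coercivity: by Hölder and Poincaré the linear term is at most a multiple of `Y ^ (1 / p)`, and
Young's inequality absorbs it into half of the gradient term. -/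
theorem exists_energy_bound (hp : 1 < p) (hΩ : volume Ω ≠ ⊤) {C : ℝ} (hC : 0 ≤ C)
    (hP : ∀ φ, IsTestFunction Ω φ →
      ∫ x in Ω, ‖φ x‖ ^ p ≤ C * ∫ x in Ω, ‖∇ φ x‖ ^ p) :
    ∃ K, ∀ φ, IsTestFunction Ω φ → (∫ x in Ω, ‖∇ φ x‖ ^ p) / (2 * p) - K ≤ energy p Ω φ := by
  have hp0 : 0 < p := by linarith
  have : IsFiniteMeasure (volume.restrict Ω) := ⟨by simpa [lt_top_iff_ne_top] using hΩ⟩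
  set Z := (volume.real Ω) ^ (1 - 1 / p) * C ^ (1 / p) with hZ
  have hZ0 : 0 ≤ Z := by positivity
  -- The constant left over when Young is applied to `(Y / 2) ^ (1 / p)` times `Z * 2 ^ (1 / p)`;
  -- the other term is `Y / (2 * p)`.
  refine ⟨|Z * 2 ^ (1 / p)| ^ p.conjExponent / p.conjExponent, fun φ hφ => ?_⟩
  set Y := ∫ x in Ω, ‖∇ φ x‖ ^ p with hY
  have hY0 : 0 ≤ Y := integral_nonneg fun x => Real.rpow_nonneg (norm_nonneg _) _
  have h1 := abs_integral_le_rpow hp (hφ.memLp (ENNReal.ofReal p))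
  have h2 : (∫ x in Ω, ‖φ x‖ ^ p) ^ (1 / p) ≤ C ^ (1 / p) * Y ^ (1 / p) := by
    rw [← Real.mul_rpow hC hY0]
    exact Real.rpow_le_rpow (integral_nonneg fun x => Real.rpow_nonneg (norm_nonneg _) _)
      (hP φ hφ) (by positivity)
  have h3 : |∫ x in Ω, φ x| ≤ Z * Y ^ (1 / p) := by
    refine h1.trans ?_
    simp only [measureReal_restrict_apply_univ]
    rw [hZ, mul_assoc]
    gcongr
  have h4 := Real.young_inequality ((Y / 2) ^ (1 / p)) (Z * 2 ^ (1 / p))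
    (Real.HolderConjugate.conjExponent hp)
  have h5 : |(Y / 2) ^ (1 / p)| ^ p = Y / 2 := by
    rw [abs_of_nonneg (by positivity), ← Real.rpow_mul (by positivity),
      one_div_mul_cancel hp0.ne', Real.rpow_one]
  have h6 : (Y / 2) ^ (1 / p) * (Z * 2 ^ (1 / p)) = Z * Y ^ (1 / p) := by
    rw [Real.div_rpow hY0 (by norm_num)]
    field_simp
  rw [h5, h6] at h4
  have h7 := le_abs_self (∫ x in Ω, φ x)
  have h8 : Y / p = Y / (2 * p) + Y / 2 / p := by field_simp; norm_num
  rw [energy, ← hY]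
  linarith

/-- The midpoint of `φ` and `ψ` is a test function, so its energy is at least `m`. The linear part
of the energy cancels in the midpoint defect, so the integrated convexity defect of the gradients is
`p` times the energy defect. -/
theorem integral_norm_sub_gradient_rpow_le (hp : 1 < p) {ε C : ℝ} (hC : 0 ≤ C)
    (hU : ∀ a b : EuclideanSpace ℝ (Fin D),
      ‖a - b‖ ^ p ≤ ε * (‖a‖ ^ p + ‖b‖ ^ p) +
        C * ((‖a‖ ^ p + ‖b‖ ^ p) / 2 - ‖(1 / 2 : ℝ) • (a + b)‖ ^ p))
    {m : ℝ} (hm : ∀ φ, IsTestFunction Ω φ → m ≤ energy p Ω φ)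
    {φ ψ : EuclideanSpace ℝ (Fin D) → ℝ} (hφ : IsTestFunction Ω φ) (hψ : IsTestFunction Ω ψ) :
    ∫ x in Ω, ‖∇ φ x - ∇ ψ x‖ ^ p ≤
      ε * ((∫ x in Ω, ‖∇ φ x‖ ^ p) + ∫ x in Ω, ‖∇ ψ x‖ ^ p) +
        C * p * ((energy p Ω φ + energy p Ω ψ) / 2 - m) := by
  have hp0 : 0 < p := by linarith
  have hmid := (hφ.add hψ).smul (1 / 2)
  have hgmid : ∇ ((1 / 2 : ℝ) • (φ + ψ)) = fun x => (1 / 2 : ℝ) • (∇ φ x + ∇ ψ x) := by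
    rw [(hφ.add hψ).gradient_smul, hφ.gradient_add hψ]; rfl
  have i1 := integrable_norm_rpow hp (hφ.memLp_gradient (ENNReal.ofReal p))
  have i2 := integrable_norm_rpow hp (hψ.memLp_gradient (ENNReal.ofReal p))
  have i3 := integrable_norm_rpow hp (hmid.memLp_gradient (ENNReal.ofReal p))
  have i4 := integrable_norm_rpow hp ((hφ.memLp_gradient (ENNReal.ofReal p)).sub
    (hψ.memLp_gradient (ENNReal.ofReal p)))
  have h1 := hm _ hmid
  simp only [hgmid] at i3
  have hint : ∫ x in Ω, ((1 / 2 : ℝ) • (φ + ψ)) x =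
      ((∫ x in Ω, φ x) + ∫ x in Ω, ψ x) / 2 := by
    have j1 := memLp_one_iff_integrable.1 (hφ.memLp 1)
    have j2 := memLp_one_iff_integrable.1 (hψ.memLp 1)
    simp only [Pi.smul_apply, Pi.add_apply, smul_eq_mul]
    rw [integral_const_mul, integral_add j1 j2]
    ring
  rw [energy, hgmid, hint] at h1
  have h2 : ∫ x in Ω, ‖∇ φ x - ∇ ψ x‖ ^ p ≤ ∫ x in Ω, (ε * (‖∇ φ x‖ ^ p + ‖∇ ψ x‖ ^ p) +
      C * ((‖∇ φ x‖ ^ p + ‖∇ ψ x‖ ^ p) / 2 - ‖(1 / 2 : ℝ) • (∇ φ x + ∇ ψ x)‖ ^ p)) :=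
    integral_mono i4 (((i1.add i2).const_mul ε).add ((((i1.add i2).div_const 2).sub i3).const_mul C))
      fun x => hU _ _
  have i5 : Integrable (fun x => ε * (‖∇ φ x‖ ^ p + ‖∇ ψ x‖ ^ p)) (volume.restrict Ω) :=
    (i1.add i2).const_mul ε
  have i6 : Integrable (fun x => (‖∇ φ x‖ ^ p + ‖∇ ψ x‖ ^ p) / 2) (volume.restrict Ω) :=
    (i1.add i2).div_const 2
  have i7 : Integrable (fun x => C * ((‖∇ φ x‖ ^ p + ‖∇ ψ x‖ ^ p) / 2 -
      ‖(1 / 2 : ℝ) • (∇ φ x + ∇ ψ x)‖ ^ p)) (volume.restrict Ω) := (i6.sub i3).const_mul C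
  rw [integral_add i5 i7, integral_const_mul, integral_const_mul,
    integral_sub i6 i3, integral_div, integral_add i1 i2] at h2
  refine h2.trans ?_
  rw [mul_assoc C p]
  gcongr
  rw [energy, energy]
  field_simp
  field_simp at h1
  linarith

end Energy

/-! ### First variation of the `p`-Dirichlet integral -/

section EulerLagrange

variable {α : Type*} [MeasurableSpace α] {μ : Measure α} {F : Type*} [NormedAddCommGroup F]
  [InnerProductSpace ℝ F] {p : ℝ}

theorem norm_rpow_sub_two_smul (hp : 1 < p) (v : F) : ‖‖v‖ ^ (p - 2) • v‖ = ‖v‖ ^ (p - 1) := by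
  rw [norm_smul, Real.norm_of_nonneg (by positivity)]
  rcases eq_or_ne v 0 with rfl | hv
  · simp [Real.zero_rpow (by linarith : p - 1 ≠ 0)]
  · have : 0 < ‖v‖ := norm_pos_iff.2 hv
    rw [← Real.rpow_add_one this.ne']
    congr 1; ring

theorem abs_inner_rpow_le (hp : 1 < p) (v w : F) :
    |inner ℝ (‖v‖ ^ (p - 2) • v) w| ≤ ‖v‖ ^ (p - 1) * ‖w‖ := by
  rw [← norm_rpow_sub_two_smul hp]
  exact abs_real_inner_le_norm _ _

theorem inner_rpow_self (hp : 1 < p) (v : F) : inner ℝ (‖v‖ ^ (p - 2) • v) v = ‖v‖ ^ p := by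
  rcases eq_or_ne v 0 with rfl | hv
  · simp [Real.zero_rpow (by linarith : p ≠ 0)]
  · have : 0 < ‖v‖ := norm_pos_iff.2 hv
    rw [inner_smul_left, real_inner_self_eq_norm_sq, conj_trivial, ← Real.rpow_natCast,
      ← Real.rpow_add this]
    congr 1; push_cast; ring

theorem aestronglyMeasurable_inner_rpow {G H : α → F}
    (hG : AEStronglyMeasurable G μ) (hH : AEStronglyMeasurable H μ) :
    AEStronglyMeasurable (fun x => inner ℝ (‖G x‖ ^ (p - 2) • G x) (H x)) μ :=
  ((hG.norm.aemeasurable.pow_const (p - 2)).aestronglyMeasurable.smul hG).inner hH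

theorem abs_integral_inner_rpow_le (hp : 1 < p) {G H : α → F} (hG : MemLp G (ENNReal.ofReal p) μ)
    (hH : MemLp H (ENNReal.ofReal p) μ) :
    |∫ x, inner ℝ (‖G x‖ ^ (p - 2) • G x) (H x) ∂μ| ≤
      (∫ x, ‖G x‖ ^ p ∂μ) ^ (1 - 1 / p) * (∫ x, ‖H x‖ ^ p ∂μ) ^ (1 / p) := by
  obtain ⟨h1, h2⟩ := integral_norm_rpow_sub_one_mul_le hp hG hH
  exact (norm_integral_le_of_norm_le (f := fun x => inner ℝ (‖G x‖ ^ (p - 2) • G x) (H x)) h1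
    (.of_forall fun _ => abs_inner_rpow_le hp _ _)).trans h2

theorem abs_inner_rpow_add_smul_le (hp : 1 < p) (v w : F) {t : ℝ} (ht : ‖t‖ ≤ 1) :
    |inner ℝ (‖v + t • w‖ ^ (p - 2) • (v + t • w)) w| ≤ (‖v‖ + ‖w‖) ^ p := by
  have h1 : ‖v + t • w‖ ≤ ‖v‖ + ‖w‖ := by
    refine (norm_add_le _ _).trans ?_
    rw [norm_smul]
    have := mul_le_of_le_one_left (norm_nonneg w) ht
    linarith
  have h0 : 0 ≤ ‖v‖ + ‖w‖ := by positivity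
  have h2 : (‖v‖ + ‖w‖) ^ p = (‖v‖ + ‖w‖) ^ (p - 1) * (‖v‖ + ‖w‖) := by
    rcases h0.eq_or_lt with h | h
    · rw [← h, Real.zero_rpow (by linarith), mul_zero]
    · rw [← Real.rpow_add_one h.ne']; congr 1; ring
  rw [h2]
  have h3 : ‖w‖ ≤ ‖v‖ + ‖w‖ := by linarith [norm_nonneg v]
  have h4 : ‖v + t • w‖ ^ (p - 1) ≤ (‖v‖ + ‖w‖) ^ (p - 1) :=
    Real.rpow_le_rpow (norm_nonneg _) h1 (by linarith)
  exact (abs_inner_rpow_le hp _ _).trans (mul_le_mul h4 h3 (norm_nonneg _) (by positivity))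

theorem hasDerivAt_norm_add_smul_rpow (hp : 1 < p) (v w : F) (t : ℝ) :
    HasDerivAt (fun t : ℝ => ‖v + t • w‖ ^ p)
      (p * inner ℝ (‖v + t • w‖ ^ (p - 2) • (v + t • w)) w) t := by
  have h1 : HasDerivAt (fun t : ℝ => v + t • w) w t := by
    simpa using ((hasDerivAt_id t).smul_const w).const_add v
  have h2 := (hasFDerivAt_norm_rpow (v + t • w) hp).comp_hasDerivAt t h1
  refine h2.congr_deriv ?_
  rw [_root_.smul_apply, innerSL_apply_apply, real_inner_smul_left, smul_eq_mul,
    mul_assoc]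

/-- Differentiation under the integral; for `|t| < 1` the derivatives are dominated by `p * (‖G‖ +
‖H‖) ^ p`. -/
theorem hasDerivAt_integral_norm_rpow (hp : 1 < p) {G H : α → F}
    (hG : MemLp G (ENNReal.ofReal p) μ) (hH : MemLp H (ENNReal.ofReal p) μ) :
    HasDerivAt (fun t : ℝ => ∫ x, ‖G x + t • H x‖ ^ p ∂μ)
      (p * ∫ x, inner ℝ (‖G x‖ ^ (p - 2) • G x) (H x) ∂μ) 0 := by
  have hp0 : 0 < p := by linarith
  have hsum : Integrable (fun x => (‖G x‖ + ‖H x‖) ^ p) μ := by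
    refine (integrable_norm_rpow hp (hG.norm.add hH.norm)).congr (.of_forall fun x => ?_)
    simp only [Pi.add_apply]
    rw [Real.norm_of_nonneg (by positivity)]
  have hmeas : ∀ t : ℝ, AEStronglyMeasurable (fun x => ‖G x + t • H x‖ ^ p) μ := fun t =>
    (integrable_norm_rpow hp (hG.add (hH.const_smul t))).1
  have hint : Integrable (fun x => ‖G x + (0 : ℝ) • H x‖ ^ p) μ :=
    integrable_norm_rpow hp (hG.add (hH.const_smul (0 : ℝ)))
  have hmeas' : AEStronglyMeasurable (fun x => p *
      inner ℝ (‖G x + (0 : ℝ) • H x‖ ^ (p - 2) • (G x + (0 : ℝ) • H x)) (H x)) μ :=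
    (aestronglyMeasurable_inner_rpow (hG.add (hH.const_smul (0 : ℝ))).1 hH.1).const_mul p
  have hbound : ∀ᵐ x ∂μ, ∀ t ∈ Metric.ball (0 : ℝ) 1,
      ‖p * inner ℝ (‖G x + t • H x‖ ^ (p - 2) • (G x + t • H x)) (H x)‖ ≤
        p * (‖G x‖ + ‖H x‖) ^ p := by
    refine .of_forall fun x t ht => ?_
    rw [norm_mul, Real.norm_of_nonneg hp0.le]
    exact mul_le_mul_of_nonneg_left (abs_inner_rpow_add_smul_le hp _ _
      (mem_ball_zero_iff.1 ht).le) hp0.le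
  have key := (hasDerivAt_integral_of_dominated_loc_of_deriv_le (Metric.ball_mem_nhds _ one_pos)
    (.of_forall hmeas) hint hmeas' hbound (hsum.const_mul p)
    (.of_forall fun x t _ => hasDerivAt_norm_add_smul_rpow hp (G x) (H x) t)).2
  simp only [zero_smul, add_zero] at key
  rwa [integral_const_mul] at key

end EulerLagrange

/-! ### Minimising sequences -/

section Existence

variable {D : ℕ} {Ω : Set (EuclideanSpace ℝ (Fin D))} {p : ℝ}

/-- Coercivity bounds the gradients of a minimising sequence, and uniform convexity then makes them
Cauchy in `L^p`. Convergence is thus strong and no weak compactness is used. -/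
theorem exists_minimizing_seq (hp : 1 < p) (hΩ : volume Ω ≠ ⊤) {C : ℝ} (hC : 0 ≤ C)
    (hP : ∀ φ, IsTestFunction Ω φ →
      ∫ x in Ω, ‖φ x‖ ^ p ≤ C * ∫ x in Ω, ‖∇ φ x‖ ^ p) :
    ∃ (m : ℝ) (φ : ℕ → EuclideanSpace ℝ (Fin D) → ℝ),
      (∀ ψ, IsTestFunction Ω ψ → m ≤ energy p Ω ψ) ∧ (∀ n, IsTestFunction Ω (φ n)) ∧
      Tendsto (fun n => energy p Ω (φ n)) atTop (𝓝 m) ∧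
      ∀ ε > 0, ∃ N, ∀ k ≥ N, ∀ l ≥ N, ∫ x in Ω, ‖∇ (φ k) x - ∇ (φ l) x‖ ^ p < ε := by
  have hp0 : 0 < p := by linarith
  obtain ⟨K, hK⟩ := exists_energy_bound hp hΩ hC hP
  set S : Set ℝ := {e | ∃ ψ, IsTestFunction Ω ψ ∧ energy p Ω ψ = e} with hS
  have hne : S.Nonempty := ⟨_, 0, IsTestFunction.zero, rfl⟩
  have hnn : ∀ ψ : EuclideanSpace ℝ (Fin D) → ℝ, 0 ≤ ∫ x in Ω, ‖∇ ψ x‖ ^ p := fun ψ =>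
    integral_nonneg fun x => Real.rpow_nonneg (norm_nonneg _) _
  have hbdd : BddBelow S := by
    refine ⟨-K, ?_⟩
    rintro _ ⟨ψ, hψ, rfl⟩
    have := hK ψ hψ
    have : 0 ≤ (∫ x in Ω, ‖∇ ψ x‖ ^ p) / (2 * p) := div_nonneg (hnn ψ) (by positivity)
    linarith
  have hm : ∀ ψ, IsTestFunction Ω ψ → sInf S ≤ energy p Ω ψ := fun ψ hψ =>
    csInf_le hbdd ⟨ψ, hψ, rfl⟩
  obtain ⟨e, -, he, heS⟩ := exists_seq_tendsto_sInf hne hbdd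
  choose φ hφ hφe using heS
  have hlim : Tendsto (fun n => energy p Ω (φ n)) atTop (𝓝 (sInf S)) := by simpa only [hφe] using he
  refine ⟨sInf S, φ, hm, hφ, hlim, fun ε hε => ?_⟩
  -- A bound for the gradient integrals once the energy is within `1` of its infimum. With the
  -- choices below, the convexity term costs `ε / 2` and the energy defect `ε / 4`; the `+ 1` in `C'
  -- * p + 1` covers `C' = 0`.
  set B := 2 * p * (|sInf S| + 1 + |K|) with hB
  have hBpos : 0 < B := by positivity
  obtain ⟨C', hC', hU⟩ := exists_norm_sub_rpow_le (F := EuclideanSpace ℝ (Fin D)) hp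
    (ε := ε / (4 * B)) (by positivity)
  have hev : ∀ᶠ n in atTop, energy p Ω (φ n) < sInf S + min 1 (ε / (4 * (C' * p + 1))) :=
    hlim.eventually (gt_mem_nhds (by
      have : 0 < min 1 (ε / (4 * (C' * p + 1))) := lt_min one_pos (by positivity)
      linarith))
  obtain ⟨N, hN⟩ := eventually_atTop.1 hev
  have hbound : ∀ n ≥ N, ∫ x in Ω, ‖∇ (φ n) x‖ ^ p ≤ B := by
    intro n hn
    have h1 := hK _ (hφ n)
    have h2 := hN n hn
    have h3 : min 1 (ε / (4 * (C' * p + 1))) ≤ 1 := min_le_left _ _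
    have h4 := le_abs_self (sInf S)
    have h5 := le_abs_self K
    have h6 : (∫ x in Ω, ‖∇ (φ n) x‖ ^ p) / (2 * p) ≤ |sInf S| + 1 + |K| := by linarith
    rw [div_le_iff₀ (by positivity)] at h6
    linarith
  refine ⟨N, fun k hk l hl => ?_⟩
  have h1 := integral_norm_sub_gradient_rpow_le hp hC' hU hm (hφ k) (hφ l)
  have h2 : ε / (4 * B) * ((∫ x in Ω, ‖∇ (φ k) x‖ ^ p) + ∫ x in Ω, ‖∇ (φ l) x‖ ^ p) ≤ ε / 2 := by
    calc _ ≤ ε / (4 * B) * (B + B) := by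
          gcongr
          exacts [hbound k hk, hbound l hl]
      _ = ε / 2 := by field_simp; ring
  have h3 : C' * p * ((energy p Ω (φ k) + energy p Ω (φ l)) / 2 - sInf S) ≤ ε / 4 := by
    have h4 : (energy p Ω (φ k) + energy p Ω (φ l)) / 2 - sInf S ≤ ε / (4 * (C' * p + 1)) := by
      have h5 := hN k hk
      have h6 := hN l hl
      have h7 : min 1 (ε / (4 * (C' * p + 1))) ≤ ε / (4 * (C' * p + 1)) := min_le_right _ _
      linarith
    calc _ ≤ (C' * p + 1) * (ε / (4 * (C' * p + 1))) := by
          refine mul_le_mul (by linarith) h4 ?_ (by positivity)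
          have := hm _ (hφ k)
          have := hm _ (hφ l)
          linarith
      _ = ε / 4 := by field_simp
  linarith

end Existence

/-! ### Strong `L^p` convergence -/

section LpConvergence

variable {α : Type*} [MeasurableSpace α] {μ : Measure α} {F : Type*} [NormedAddCommGroup F]
  {p : ℝ}

theorem fact_one_le_ofReal (hp : 1 < p) : Fact (1 ≤ ENNReal.ofReal p) :=
  ⟨by simpa using hp.le⟩

theorem exists_memLp_limit [CompleteSpace F] (hp : 1 < p) {f : ℕ → α → F}
    (hf : ∀ n, MemLp (f n) (ENNReal.ofReal p) μ)
    (hc : ∀ ε > 0, ∃ N, ∀ k ≥ N, ∀ l ≥ N, ∫ x, ‖f k x - f l x‖ ^ p ∂μ < ε) :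
    ∃ g, MemLp g (ENNReal.ofReal p) μ ∧
      Tendsto (fun n => eLpNorm (fun x => f n x - g x) (ENNReal.ofReal p) μ) atTop (𝓝 0) := by
  have hp0 : 0 < p := by linarith
  have := fact_one_le_ofReal hp
  have hcs : CauchySeq fun n => (hf n).toLp (f n) := by
    refine Metric.cauchySeq_iff.2 fun ε hε => ?_
    obtain ⟨N, hN⟩ := hc (ε ^ p) (by positivity)
    refine ⟨N, fun k hk l hl => ?_⟩
    have h1 := hN k hk l hl
    have h2 := integral_norm_rpow_eq hp ((hf k).sub (hf l))
    simp only [Pi.sub_apply] at h2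
    rw [h2, MemLp.toLp_sub (hf k) (hf l)] at h1
    rw [dist_eq_norm]
    exact (Real.rpow_lt_rpow_iff (norm_nonneg _) hε.le hp0).1 h1
  obtain ⟨g, hg⟩ := cauchySeq_tendsto_of_complete hcs
  refine ⟨g, Lp.memLp g, ?_⟩
  have h := (Lp.tendsto_Lp_iff_tendsto_eLpNorm'' f hf g (Lp.memLp g)).1 (by simpa using hg)
  exact h

theorem tendsto_integral_norm_rpow (hp : 1 < p) {f : ℕ → α → F} {g : α → F}
    (hf : ∀ n, MemLp (f n) (ENNReal.ofReal p) μ) (hg : MemLp g (ENNReal.ofReal p) μ)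
    (h : Tendsto (fun n => eLpNorm (fun x => f n x - g x) (ENNReal.ofReal p) μ) atTop (𝓝 0)) :
    Tendsto (fun n => ∫ x, ‖f n x‖ ^ p ∂μ) atTop (𝓝 (∫ x, ‖g x‖ ^ p ∂μ)) := by
  have := fact_one_le_ofReal hp
  have h1 := (Lp.tendsto_Lp_iff_tendsto_eLpNorm'' f hf g hg).2 h
  simp only [integral_norm_rpow_eq hp (hf _), integral_norm_rpow_eq hp hg]
  exact h1.norm.rpow_const (Or.inr (by linarith))

/-- Strong `L^p` convergence passes to the limit in pairings with `L^{p'}` functions. -/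
theorem tendsto_integral_pairing (hp : 1 < p) {G W : Type*} [NormedAddCommGroup G]
    [NormedAddCommGroup W] [NormedSpace ℝ W] (b : F → G → W)
    (hbc : Continuous fun z : F × G => b z.1 z.2)
    (hsub : ∀ x y z, b (x - y) z = b x z - b y z) (hb : ∀ x z, ‖b x z‖ ≤ ‖x‖ * ‖z‖)
    {f : ℕ → α → F} {g : α → F} {w : α → G}
    (hf : ∀ n, MemLp (f n) (ENNReal.ofReal p) μ) (hg : MemLp g (ENNReal.ofReal p) μ)
    (hw : MemLp w (ENNReal.ofReal p.conjExponent) μ)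
    (h : Tendsto (fun n => eLpNorm (fun x => f n x - g x) (ENNReal.ofReal p) μ) atTop (𝓝 0)) :
    Tendsto (fun n => ∫ x, b (f n x) (w x) ∂μ) atTop (𝓝 (∫ x, b (g x) (w x) ∂μ)) := by
  have : ENNReal.HolderTriple (ENNReal.ofReal p) (ENNReal.ofReal p.conjExponent) 1 :=
    (Real.HolderConjugate.conjExponent hp).ennrealOfReal
  have hm : ∀ {u : α → F}, MemLp u (ENNReal.ofReal p) μ → MemLp (fun x => b (u x) (w x)) 1 μ := by
    intro u hu
    exact MemLp.of_bilin b 1 hu hw (hbc.comp_aestronglyMeasurable (hu.1.prodMk hw.1))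
      (.of_forall fun x => by rw [one_mul]; exact hb _ _)
  refine tendsto_integral_of_L1' _ (hm hg).1
    (.of_forall fun n => memLp_one_iff_integrable.1 (hm (hf n))) ?_
  have h1 : ∀ n, eLpNorm ((fun x => b (f n x) (w x)) - fun x => b (g x) (w x)) 1 μ ≤
      eLpNorm (fun x => f n x - g x) (ENNReal.ofReal p) μ *
        eLpNorm w (ENNReal.ofReal p.conjExponent) μ := by
    intro n
    have h2 := eLpNorm_le_eLpNorm_mul_eLpNorm_of_nnnorm (p := ENNReal.ofReal p)
      (q := ENNReal.ofReal p.conjExponent) (r := 1) (μ := μ) ((hf n).sub hg).1 hw.1 b 1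
      (.of_forall fun x => by rw [one_mul]; exact hb _ _)
    simp only [Pi.sub_apply, hsub, ENNReal.coe_one, one_mul] at h2
    exact h2
  have h3 := ENNReal.Tendsto.mul_const h (Or.inr hw.eLpNorm_ne_top)
  rw [zero_mul] at h3
  exact tendsto_of_tendsto_of_tendsto_of_le_of_le tendsto_const_nhds h3 (fun _ => zero_le) h1

theorem tendsto_integral_of_tendsto_eLpNorm [IsFiniteMeasure μ] (hp : 1 < p) {f : ℕ → α → ℝ}
    {g : α → ℝ} (hf : ∀ n, MemLp (f n) (ENNReal.ofReal p) μ) (hg : MemLp g (ENNReal.ofReal p) μ)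
    (h : Tendsto (fun n => eLpNorm (fun x => f n x - g x) (ENNReal.ofReal p) μ) atTop (𝓝 0)) :
    Tendsto (fun n => ∫ x, f n x ∂μ) atTop (𝓝 (∫ x, g x ∂μ)) := by
  simpa using tendsto_integral_pairing hp (fun x y : ℝ => x * y) continuous_mul
    (fun x y z => sub_mul x y z) (fun x z => (norm_mul x z).le) hf hg
    (memLp_const (1 : ℝ)) h

end LpConvergence

/-! ### Torsion functions: existence and variational bounds -/

section Torsion

variable {D : ℕ} {Ω : Set (EuclideanSpace ℝ (Fin D))} {p : ℝ}

/-- The torsion function is the `L^p` limit `u` of a minimising sequence and `G` the limit of its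
gradients. Integration by parts passes to the limit, and the equation says that `t = 0` is critical
for the energy of `G + t • ∇ ψ`. -/
theorem exists_isTorsionFunction (hp : 1 < p) (hΩ : volume Ω ≠ ⊤) {C : ℝ} (hC : 0 ≤ C)
    (hP : ∀ φ, IsTestFunction Ω φ →
      ∫ x in Ω, ‖φ x‖ ^ p ≤ C * ∫ x in Ω, ‖∇ φ x‖ ^ p) :
    ∃ u, IsTorsionFunction p Ω u := by
  have hp0 : 0 < p := by linarith
  have : IsFiniteMeasure (volume.restrict Ω) := ⟨by simpa [lt_top_iff_ne_top] using hΩ⟩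
  obtain ⟨m, φ, hm, hφ, hlim, hcau⟩ := exists_minimizing_seq hp hΩ hC hP
  have hG : ∀ n, MemLp (∇ (φ n)) (ENNReal.ofReal p) (volume.restrict Ω) := fun n =>
    (hφ n).memLp_gradient _
  have hU : ∀ n, MemLp (φ n) (ENNReal.ofReal p) (volume.restrict Ω) := fun n => (hφ n).memLp _
  obtain ⟨G, hGm, hGlim⟩ := exists_memLp_limit hp hG hcau
  -- Poincaré transfers the Cauchy property from the gradients to the functions.
  have hcau' : ∀ ε > 0, ∃ N, ∀ k ≥ N, ∀ l ≥ N, ∫ x in Ω, ‖φ k x - φ l x‖ ^ p < ε := by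
    intro ε hε
    obtain ⟨N, hN⟩ := hcau (ε / (C + 1)) (by positivity)
    refine ⟨N, fun k hk l hl => ?_⟩
    have h1 := hP _ ((hφ k).add ((hφ l).smul (-1)))
    rw [(hφ k).gradient_add ((hφ l).smul (-1)), (hφ l).gradient_smul] at h1
    simp only [Pi.add_apply, neg_smul, one_smul, Pi.neg_apply, ← sub_eq_add_neg] at h1
    have h2 := hN k hk l hl
    have h3 : 0 ≤ ∫ x in Ω, ‖∇ (φ k) x - ∇ (φ l) x‖ ^ p :=
      integral_nonneg fun x => Real.rpow_nonneg (norm_nonneg _) _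
    rw [lt_div_iff₀ (by positivity)] at h2
    linarith
  obtain ⟨u, hum, hulim⟩ := exists_memLp_limit hp hU hcau'
  refine ⟨u, G, ⟨⟨hum, hGm, fun ψ hψ => ?_⟩, φ, hφ, hulim, hGlim⟩, fun ψ hψ => ?_⟩
  · have t1 := tendsto_integral_pairing hp
      (fun (x : ℝ) (y : EuclideanSpace ℝ (Fin D)) => x • y) continuous_smul
      (fun x y z => sub_smul x y z) (fun x z => (norm_smul x z).le) hU hum (hψ.memLp_gradient _)
      hulim
    have t2 := (tendsto_integral_pairing hp
      (fun (y : EuclideanSpace ℝ (Fin D)) (x : ℝ) => x • y)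
      (continuous_snd.smul continuous_fst)
      (fun x y z => smul_sub z x y) (fun x z => by rw [norm_smul, mul_comm]) hG hGm
      (hψ.memLp _) hGlim).neg
    refine tendsto_nhds_unique t1 (t2.congr fun n => ?_)
    have hΨ : ∀ v : EuclideanSpace ℝ (Fin D),
        ∫ x, φ n x * fderiv ℝ ψ x v = -∫ x, fderiv ℝ (φ n) x v * ψ x := by
      intro v
      have c1 : Continuous fun x => fderiv ℝ ψ x v :=
        (hψ.smooth.continuous_fderiv (by simp)).clm_apply continuous_const
      have c2 : Continuous fun x => fderiv ℝ (φ n) x v :=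
        ((hφ n).smooth.continuous_fderiv (by simp)).clm_apply continuous_const
      exact integral_mul_fderiv_eq_neg_fderiv_mul_of_integrable
        ((c2.mul hψ.continuous).integrable_of_hasCompactSupport hψ.compact.mul_left)
        (((hφ n).continuous.mul c1).integrable_of_hasCompactSupport (hφ n).compact.mul_right)
        (((hφ n).continuous.mul hψ.continuous).integrable_of_hasCompactSupport
          hψ.compact.mul_left)
        (fun x _ => (hφ n).differentiable x) (fun x _ => hψ.differentiable x)
    have s1 : ∫ x in Ω, φ n x • ∇ ψ x = ∫ x, φ n x • ∇ ψ x :=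
      setIntegral_eq_integral_of_forall_compl_eq_zero fun x hx => by
        rw [(hφ n).eq_zero hx, zero_smul]
    have s2 : ∫ x in Ω, ψ x • ∇ (φ n) x = ∫ x, ψ x • ∇ (φ n) x :=
      setIntegral_eq_integral_of_forall_compl_eq_zero fun x hx => by
        rw [hψ.eq_zero hx, zero_smul]
    have i1 : Integrable fun x => φ n x • ∇ ψ x :=
      ((hφ n).continuous.smul hψ.continuous_gradient).integrable_of_hasCompactSupport
        (hφ n).compact.smul_right
    have i2 : Integrable fun x => ψ x • ∇ (φ n) x :=
      (hψ.continuous.smul (hφ n).continuous_gradient).integrable_of_hasCompactSupport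
        hψ.compact.smul_right
    rw [s1, s2]
    refine ext_inner_left ℝ fun v => ?_
    rw [inner_neg_right, ← integral_inner i1, ← integral_inner i2]
    have e : ∀ (f : EuclideanSpace ℝ (Fin D) → ℝ) x, inner ℝ v (∇ f x) = fderiv ℝ f x v := by
      intro f x; rw [inner_gradient_right]; simp
    simp only [inner_smul_right, e]
    rw [hΨ v]
    simp only [mul_comm]
  · have hψG := hψ.memLp_gradient (ENNReal.ofReal p)
    have hderiv := ((hasDerivAt_integral_norm_rpow hp hGm hψG).div_const p).sub
      ((hasDerivAt_id (0 : ℝ)).mul_const (∫ x in Ω, ψ x))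
    have hulim' := tendsto_integral_of_tendsto_eLpNorm hp hU hum hulim
    -- Each `φ n + t • ψ` is a test function with energy at least `m`; let `n` tend to infinity. At
    -- `t = 0` equality holds, because the sequence is minimising.
    have hmin : ∀ t : ℝ, m ≤ (∫ x in Ω, ‖G x + t • ∇ ψ x‖ ^ p) / p -
        ((∫ x in Ω, u x) + t * ∫ x in Ω, ψ x) := by
      intro t
      have l1 := tendsto_integral_norm_rpow hp (fun n => (hG n).add (hψG.const_smul t))
        (hGm.add (hψG.const_smul t)) (by simpa using hGlim)
      refine ge_of_tendsto ((l1.div_const p).sub (hulim'.add_const (t * ∫ x in Ω, ψ x)))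
        (.of_forall fun n => ?_)
      have h1 := hm _ ((hφ n).add (hψ.smul t))
      rw [energy, (hφ n).gradient_add (hψ.smul t), hψ.gradient_smul] at h1
      have h2 : ∫ x in Ω, (φ n + t • ψ) x = (∫ x in Ω, φ n x) + t * ∫ x in Ω, ψ x := by
        simp only [Pi.add_apply, Pi.smul_apply, smul_eq_mul]
        rw [integral_add (memLp_one_iff_integrable.1 ((hφ n).memLp 1))
          ((memLp_one_iff_integrable.1 (hψ.memLp 1)).const_mul t), integral_const_mul]
      rw [h2] at h1
      exact h1
    have hm0 : m = (∫ x in Ω, ‖G x‖ ^ p) / p - ∫ x in Ω, u x :=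
      tendsto_nhds_unique hlim
        (((tendsto_integral_norm_rpow hp hG hGm hGlim).div_const p).sub hulim')
    have hloc : IsLocalMin ((fun t : ℝ => (∫ x in Ω, ‖G x + t • ∇ ψ x‖ ^ p) / p) -
        fun t : ℝ => id t * ∫ x in Ω, ψ x) 0 := by
      refine .of_forall fun t => ?_
      have := hmin t
      simp only [Pi.sub_apply, zero_smul, add_zero, id, zero_mul, sub_zero]
      linarith
    have h0 := hloc.hasDerivAt_eq_zero hderiv
    rw [mul_div_cancel_left₀ _ hp0.ne'] at h0
    linarith

/-- The equation tested with `u` itself. As `u` is only a limit of test functions, the identity is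
written for the approximants and passed to the limit, the field `‖G‖ ^ (p - 2) • G` being in the
dual `L^p` space. -/
theorem IsTorsionFunction.exists_energy_identity (hp : 1 < p) (hΩ : volume Ω ≠ ⊤)
    {u : EuclideanSpace ℝ (Fin D) → ℝ} (hu : IsTorsionFunction p Ω u) :
    ∃ G, MemW10 p Ω u G ∧ ∫ x in Ω, ‖G x‖ ^ p = ∫ x in Ω, u x ∧
      ∀ φ, IsTestFunction Ω φ →
        ∫ x in Ω, inner ℝ (‖G x‖ ^ (p - 2) • G x) (∇ φ x) = ∫ x in Ω, φ x := by
  have : IsFiniteMeasure (volume.restrict Ω) := ⟨by simpa [lt_top_iff_ne_top] using hΩ⟩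
  obtain ⟨G, hG, hw⟩ := hu
  refine ⟨G, hG, ?_, hw⟩
  obtain ⟨φ, hφ, hφu, hφG⟩ := hG.approx
  have hU : ∀ n, MemLp (φ n) (ENNReal.ofReal p) (volume.restrict Ω) := fun n => (hφ n).memLp _
  have hGn : ∀ n, MemLp (∇ (φ n)) (ENNReal.ofReal p) (volume.restrict Ω) := fun n =>
    (hφ n).memLp_gradient _
  have hGp : MemLp (fun x => ‖G x‖ ^ (p - 2) • G x) (ENNReal.ofReal p.conjExponent)
      (volume.restrict Ω) := by
    refine (memLp_norm_rpow_sub_one hp hG.memLp_grad).congr_norm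
      ((hG.memLp_grad.1.norm.aemeasurable.pow_const (p - 2)).aestronglyMeasurable.smul
        hG.memLp_grad.1) (.of_forall fun x => ?_)
    rw [norm_rpow_sub_two_smul hp, Real.norm_of_nonneg (by positivity)]
  have t1 := tendsto_integral_pairing hp
    (fun (y v : EuclideanSpace ℝ (Fin D)) => inner ℝ v y)
    (continuous_snd.inner continuous_fst)
    (fun x y z => inner_sub_right z x y)
    (fun x z => by rw [mul_comm]; exact norm_inner_le_norm z x) hGn hG.memLp_grad hGp hφG
  have t2 := tendsto_integral_of_tendsto_eLpNorm hp hU hG.memLp hφu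
  simp only [inner_rpow_self hp, hw _ (hφ _)] at t1
  exact tendsto_nhds_unique t1 t2

/-- Lower bound for the torsional rigidity by the Rayleigh quotient of a test function. -/
theorem IsTorsionFunction.integral_test_le (hp : 1 < p) (hΩ : volume Ω ≠ ⊤)
    {u : EuclideanSpace ℝ (Fin D) → ℝ} (hu : IsTorsionFunction p Ω u)
    {φ : EuclideanSpace ℝ (Fin D) → ℝ} (hφ : IsTestFunction Ω φ) :
    ∫ x in Ω, φ x ≤ (∫ x in Ω, u x) ^ (1 - 1 / p) * (∫ x in Ω, ‖∇ φ x‖ ^ p) ^ (1 / p) := by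
  obtain ⟨G, hG, hid, hw⟩ := hu.exists_energy_identity hp hΩ
  rw [← hw φ hφ, ← hid]
  exact (le_abs_self _).trans
    (abs_integral_inner_rpow_le hp hG.memLp_grad (hφ.memLp_gradient _))

/-- Upper bound for the torsional rigidity from a Poincaré type inequality. -/
theorem IsTorsionFunction.integral_le (hp : 1 < p) (hΩ : volume Ω ≠ ⊤)
    {u : EuclideanSpace ℝ (Fin D) → ℝ} (hu : IsTorsionFunction p Ω u) {C : ℝ} (hC : 0 ≤ C)
    (h : ∀ φ, IsTestFunction Ω φ →
      ∫ x in Ω, φ x ≤ C ^ (1 - 1 / p) * (∫ x in Ω, ‖∇ φ x‖ ^ p) ^ (1 / p)) :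
    ∫ x in Ω, u x ≤ C := by
  have hp0 : 0 < p := by linarith
  have : IsFiniteMeasure (volume.restrict Ω) := ⟨by simpa [lt_top_iff_ne_top] using hΩ⟩
  obtain ⟨G, hG, hid, hw⟩ := hu.exists_energy_identity hp hΩ
  obtain ⟨φ, hφ, hφu, hφG⟩ := hG.approx
  have t1 := tendsto_integral_norm_rpow hp (fun n => (hφ n).memLp_gradient _) hG.memLp_grad hφG
  have t2 := tendsto_integral_of_tendsto_eLpNorm hp (fun n => (hφ n).memLp _) hG.memLp hφu
  have h1 := le_of_tendsto_of_tendsto' t2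
    ((t1.rpow_const (p := 1 / p) (Or.inr (by positivity))).const_mul (C ^ (1 - 1 / p)))
    fun n => h _ (hφ n)
  -- By the energy identity the limit reads `I ≤ C ^ (1 - 1 / p) * I ^ (1 / p)`, which is impossible
  -- for `C < I`.
  rw [hid] at h1
  set I := ∫ x in Ω, u x
  by_contra! hlt
  have hI : 0 < I := hC.trans_lt hlt
  have he : 0 < 1 - 1 / p := by
    rw [sub_pos, div_lt_one hp0]; exact hp
  have h2 : C ^ (1 - 1 / p) * I ^ (1 / p) < I ^ (1 - 1 / p) * I ^ (1 / p) := by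
    have := Real.rpow_lt_rpow hC hlt he
    have := Real.rpow_pos_of_pos hI (1 / p)
    gcongr
  rw [← Real.rpow_add hI, sub_add_cancel, Real.rpow_one] at h2
  linarith

end Torsion

/-! ### A one-dimensional inequality integrated over a subgraph -/

section Subgraph

/-- A measurable subset of the strip `0 < t ≤ R` that contains, with each point, the vertical
segment below it. -/
structure IsSubgraph (S : Set (ℝ × ℝ)) (R : ℝ) : Prop where
  measurableSet : MeasurableSet S
  pos : ∀ s t, (s, t) ∈ S → 0 < t
  le : ∀ s t, (s, t) ∈ S → t ≤ R
  down : ∀ s t t', (s, t) ∈ S → 0 < t' → t' ≤ t → (s, t') ∈ S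

/-- The length of the vertical sections. -/
def sectionLength (S : Set (ℝ × ℝ)) (s : ℝ) : ℝ := volume.real (Prod.mk s ⁻¹' S)

variable {S : Set (ℝ × ℝ)} {R : ℝ}

theorem measurable_sectionLength (hS : MeasurableSet S) : Measurable (sectionLength S) :=
  (measurable_measure_prodMk_left hS).ennreal_toReal

theorem sectionLength_nonneg (s : ℝ) : 0 ≤ sectionLength S s := measureReal_nonneg

/-- The section is an interval from `0` to its supremum, which is therefore its length; whether the
upper endpoint belongs to it is left open, being null. -/
theorem IsSubgraph.section_subset (h : IsSubgraph S R) (s : ℝ) :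
    Ioo 0 (sectionLength S s) ⊆ Prod.mk s ⁻¹' S ∧ Prod.mk s ⁻¹' S ⊆ Ioc 0 (sectionLength S s) := by
  set A := Prod.mk s ⁻¹' S with hA
  rcases A.eq_empty_or_nonempty with he | ⟨t₀, ht₀⟩
  · have : sectionLength S s = 0 := by rw [sectionLength, ← hA, he]; simp
    simp [this, he]
  have hbdd : BddAbove A := ⟨R, fun t ht => h.le s t ht⟩
  have hsub : A ⊆ Ioc 0 (sSup A) := fun t ht => ⟨h.pos s t ht, le_csSup hbdd ht⟩
  have hsup : Ioo 0 (sSup A) ⊆ A := by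
    rintro t ⟨ht0, ht⟩
    obtain ⟨t', ht', htt'⟩ := exists_lt_of_lt_csSup ⟨t₀, ht₀⟩ ht
    exact h.down s t' t ht' ht0 htt'.le
  have h0 : 0 ≤ sSup A := (hsub ht₀).1.le.trans (hsub ht₀).2
  have hv : sectionLength S s = sSup A := by
    have h1 : volume A ≤ ENNReal.ofReal (sSup A) := by
      simpa using measure_mono (μ := volume) hsub
    have h2 : ENNReal.ofReal (sSup A) ≤ volume A := by
      simpa using measure_mono (μ := volume) hsup
    rw [sectionLength, ← hA, Measure.real, le_antisymm h1 h2, ENNReal.toReal_ofReal h0]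
  rw [hv]
  exact ⟨hsup, hsub⟩

theorem IsSubgraph.le_sectionLength (h : IsSubgraph S R) {s t : ℝ} (hst : (s, t) ∈ S) :
    t ≤ sectionLength S s := ((h.section_subset s).2 hst).2

theorem IsSubgraph.sectionLength_le (h : IsSubgraph S R) (hR : 0 ≤ R) (s : ℝ) :
    sectionLength S s ≤ R := by
  by_contra! hlt
  obtain ⟨t, ht⟩ := exists_between hlt
  have := h.le s t ((h.section_subset s).1 ⟨hR.trans_lt ht.1, ht.2⟩)
  linarith [ht.1]

theorem IsSubgraph.setIntegral_eq (h : IsSubgraph S R) {f : ℝ × ℝ → ℝ} (hf : IntegrableOn f S) :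
    ∫ z in S, f z = ∫ s, ∫ t in (0)..(sectionLength S s), f (s, t) := by
  rw [← integral_indicator h.measurableSet, Measure.volume_eq_prod, integral_prod]
  · refine integral_congr_ae (.of_forall fun s => ?_)
    have e : (fun t => S.indicator f (s, t)) = (Prod.mk s ⁻¹' S).indicator fun t => f (s, t) := by
      rfl
    simp only [e]
    rw [integral_indicator (measurable_prodMk_left h.measurableSet),
      intervalIntegral.integral_of_le (sectionLength_nonneg s)]
    refine setIntegral_congr_set ((LE.le.eventuallyLE (h.section_subset s).2).antisymm ?_)
    exact Ioo_ae_eq_Ioc.symm.le.trans (LE.le.eventuallyLE (h.section_subset s).1)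
  · rw [← Measure.volume_eq_prod]
    exact hf.integrable_indicator h.measurableSet

theorem integrableOn_of_bounded {α : Type*} [MeasurableSpace α] {μ : Measure α} {A : Set α}
    (hA : MeasurableSet A) (hμ : μ A ≠ ⊤) {f : α → ℝ} (hf : AEStronglyMeasurable f μ) {C : ℝ}
    (hC : ∀ x ∈ A, |f x| ≤ C) : IntegrableOn f A μ :=
  Measure.integrableOn_of_bounded hμ hf ((ae_restrict_iff' hA).2 (.of_forall hC))

/-- One-dimensional integration by parts on the vertical sections. -/
theorem IsSubgraph.setIntegral_eq_mul_deriv (h : IsSubgraph S R) (hR : 0 ≤ R)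
    (hv : volume S ≠ ⊤) {f f' : ℝ × ℝ → ℝ} (hf : Continuous f) (hf' : Continuous f')
    (hd : ∀ s t, HasDerivAt (fun t => f (s, t)) (f' (s, t)) t) (h0 : ∀ s, f (s, 0) = 0)
    {C : ℝ} (hC : ∀ z, |f z| ≤ C) (hC' : ∀ z, |f' z| ≤ C) :
    ∫ z in S, f z = ∫ z in S, (sectionLength S z.1 - z.2) * f' z := by
  have hmeas : Measurable fun z : ℝ × ℝ => sectionLength S z.1 - z.2 :=
    ((measurable_sectionLength h.measurableSet).comp measurable_fst).sub measurable_snd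
  rw [h.setIntegral_eq (integrableOn_of_bounded h.measurableSet hv hf.aestronglyMeasurable
      fun z _ => hC z),
    h.setIntegral_eq (f := fun z => (sectionLength S z.1 - z.2) * f' z)
      (integrableOn_of_bounded (C := R * C) h.measurableSet hv
      (hmeas.aestronglyMeasurable.mul hf'.aestronglyMeasurable) ?_)]
  · refine integral_congr_ae (.of_forall fun s => ?_)
    simp only
    -- The primitive of `-1` is taken to vanish at the upper end, where `f` is not controlled; at
    -- the lower end `f` itself vanishes.
    have ibp := intervalIntegral.integral_mul_deriv_eq_deriv_mul (a := 0) (b := sectionLength S s)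
      (u := fun t => sectionLength S s - t) (u' := fun _ => -1) (v := fun t => f (s, t))
      (v' := fun t => f' (s, t)) (fun t _ => by simpa using (hasDerivAt_id t).const_sub _)
      (fun t _ => hd s t) (by simp)
      ((hf'.comp (by fun_prop : Continuous fun t : ℝ => (s, t))).intervalIntegrable _ _)
    rw [ibp, h0 s]
    simp
  · rintro ⟨s, t⟩ hz
    rw [abs_mul]
    have h1 := h.le_sectionLength hz
    have h2 := h.pos s t hz
    have h3 := h.sectionLength_le hR s
    exact mul_le_mul (abs_le.2 ⟨by simp only; linarith, by simp only; linarith⟩) (hC' _)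
      (abs_nonneg _) hR

/-- A section of length `l` contributes `l ^ (q + 1) / (q + 1)`, at most `R ^ q * l / (q + 1)`, and
the lengths integrate to the area. -/
theorem IsSubgraph.integral_sectionLength_rpow_le (h : IsSubgraph S R) (hR : 0 ≤ R)
    (hv : volume S ≠ ⊤) {q : ℝ} (hq : 0 < q) :
    ∫ z in S, (sectionLength S z.1 - z.2) ^ q ≤ R ^ q * volume.real S / (q + 1) := by
  have hmeas : Measurable fun z : ℝ × ℝ => sectionLength S z.1 - z.2 :=
    ((measurable_sectionLength h.measurableSet).comp measurable_fst).sub measurable_snd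
  have hone : IntegrableOn (fun _ : ℝ × ℝ => (1 : ℝ)) S := by simp [hv.lt_top]
  have hl : Integrable (sectionLength S) := by
    rw [Measure.volume_eq_prod] at hv
    exact Measure.integrable_measure_prodMk_left h.measurableSet hv
  have hvol : volume.real S = ∫ s, sectionLength S s := by
    have := h.setIntegral_eq hone
    simpa using this
  rw [h.setIntegral_eq (integrableOn_of_bounded (C := R ^ q) h.measurableSet hv
      (hmeas.pow_const q).aestronglyMeasurable ?_)]
  · have e : ∀ s, ∫ t in (0)..(sectionLength S s), (sectionLength S s - t) ^ q =
        sectionLength S s ^ (q + 1) / (q + 1) := by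
      intro s
      rw [intervalIntegral.integral_comp_sub_left (fun t => t ^ q), sub_self, sub_zero,
        integral_rpow (Or.inl (by linarith)), Real.zero_rpow (by linarith), sub_zero]
    simp only [e]
    rw [integral_div, hvol, ← integral_const_mul]
    refine div_le_div_of_nonneg_right ?_ (by linarith)
    have hle : ∀ s, sectionLength S s ^ (q + 1) ≤ R ^ q * sectionLength S s := by
      intro s
      rw [Real.rpow_add_one' (sectionLength_nonneg s) (by linarith)]
      exact mul_le_mul_of_nonneg_right (Real.rpow_le_rpow (sectionLength_nonneg s)
        (h.sectionLength_le hR s) hq.le) (sectionLength_nonneg s)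
    refine integral_mono_of_nonneg (.of_forall fun s => ?_) (hl.const_mul _) (.of_forall hle)
    exact Real.rpow_nonneg (sectionLength_nonneg s) _
  · rintro ⟨s, t⟩ hz
    have h1 := h.le_sectionLength hz
    have h2 := h.pos s t hz
    have h3 := h.sectionLength_le hR s
    have h4 : 0 ≤ sectionLength S s - t := by linarith
    simp only
    rw [abs_of_nonneg (Real.rpow_nonneg h4 _)]
    exact Real.rpow_le_rpow h4 (by linarith) hq.le

theorem IsSubgraph.setIntegral_le (h : IsSubgraph S R) (hR : 0 ≤ R)
    (hv : volume S ≠ ⊤) {f f' : ℝ × ℝ → ℝ} (hf : Continuous f) (hf' : Continuous f')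
    (hd : ∀ s t, HasDerivAt (fun t => f (s, t)) (f' (s, t)) t) (h0 : ∀ s, f (s, 0) = 0)
    {C : ℝ} (hC : ∀ z, |f z| ≤ C) (hC' : ∀ z, |f' z| ≤ C) {p q : ℝ} (hpq : p.HolderConjugate q) :
    ∫ z in S, f z ≤ (R ^ q * volume.real S / (q + 1)) ^ (1 / q) *
      (∫ z in S, ‖f' z‖ ^ p) ^ (1 / p) := by
  have hfin : IsFiniteMeasure (volume.restrict S) := ⟨by simpa [lt_top_iff_ne_top] using hv⟩
  have hmeas : Measurable fun z : ℝ × ℝ => sectionLength S z.1 - z.2 :=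
    ((measurable_sectionLength h.measurableSet).comp measurable_fst).sub measurable_snd
  have hb : ∀ z ∈ S, |sectionLength S z.1 - z.2| = sectionLength S z.1 - z.2 ∧
      |sectionLength S z.1 - z.2| ≤ R := by
    rintro ⟨s, t⟩ hz
    have h1 := h.le_sectionLength hz
    have h2 := h.pos s t hz
    have h3 := h.sectionLength_le hR s
    have h4 : |sectionLength S s - t| = sectionLength S s - t := abs_of_nonneg (by linarith)
    exact ⟨h4, by simp only [h4]; linarith⟩
  have m1 : MemLp (fun z : ℝ × ℝ => sectionLength S z.1 - z.2) (ENNReal.ofReal q)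
      (volume.restrict S) :=
    MemLp.of_bound hmeas.aestronglyMeasurable R
      ((ae_restrict_iff' h.measurableSet).2 (.of_forall fun z hz => (hb z hz).2))
  have m2 : MemLp f' (ENNReal.ofReal p) (volume.restrict S) :=
    MemLp.of_bound hf'.aestronglyMeasurable C (.of_forall hC')
  have hH := integral_mul_norm_le_Lp_mul_Lq hpq.symm m1 m2
  have e1 : ∫ z in S, ‖sectionLength S z.1 - z.2‖ ^ q =
      ∫ z in S, (sectionLength S z.1 - z.2) ^ q :=
    setIntegral_congr_fun h.measurableSet fun z hz => by
      simp only [Real.norm_eq_abs, (hb z hz).1]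
  rw [h.setIntegral_eq_mul_deriv hR hv hf hf' hd h0 hC hC']
  calc ∫ z in S, (sectionLength S z.1 - z.2) * f' z
      ≤ ∫ z in S, ‖sectionLength S z.1 - z.2‖ * ‖f' z‖ := by
        simp only [← norm_mul]
        exact (Real.le_norm_self _).trans (norm_integral_le_integral_norm _)
    _ ≤ _ := hH
    _ ≤ _ := by
        rw [e1]
        have hq := hpq.symm.pos
        refine mul_le_mul_of_nonneg_right (Real.rpow_le_rpow ?_
          (h.integral_sectionLength_rpow_le hR hv hq) (by positivity)) ?_
        · exact setIntegral_nonneg h.measurableSet fun z hz => Real.rpow_nonneg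
            ((hb z hz).1 ▸ abs_nonneg _) _
        · exact Real.rpow_nonneg (integral_nonneg fun z => Real.rpow_nonneg (norm_nonneg _) _) _

end Subgraph

/-! ### Upper bound for the torsion of circumscribed polygons -/

section UpperBound

/-- Isometric coordinates adapted to a side: for `x₀` on its line, `s` runs along the side and `t`
is the depth inwards. -/
theorem exists_measurePreserving_coordinates {n : EuclideanSpace ℝ (Fin 2)} (hn : ‖n‖ = 1)
    (x₀ : EuclideanSpace ℝ (Fin 2)) :
    ∃ (τ : EuclideanSpace ℝ (Fin 2)) (e : ℝ × ℝ ≃ᵐ EuclideanSpace ℝ (Fin 2)),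
      inner ℝ n τ = (0 : ℝ) ∧ MeasurePreserving e ∧ ∀ z, e z = x₀ + z.1 • τ - z.2 • n := by
  have ho : Orthonormal ℝ (({1} : Set (Fin 2)).domRestrict fun _ => -n) := by
    rw [orthonormal_iff_ite]
    intro i j
    have : i = j := Subsingleton.elim _ _
    simp [domRestrict, this, hn]
  obtain ⟨b, hb⟩ := ho.exists_orthonormalBasis_extension_of_card_eq (by simp)
  have hb1 : b 1 = -n := hb 1 rfl
  refine ⟨b 0, MeasurableEquiv.finTwoArrow.symm.trans ((MeasurableEquiv.toLp 2 (Fin 2 → ℝ)).trans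
    (b.repr.symm.toHomeomorph.toMeasurableEquiv.trans (MeasurableEquiv.addLeft x₀))), ?_, ?_, ?_⟩
  · have : inner ℝ (b 1) (b 0) = (0 : ℝ) := b.orthonormal.2 (show (1 : Fin 2) ≠ 0 by simp)
    rw [hb1, inner_neg_left, neg_eq_zero] at this
    exact this
  · refine (measurePreserving_add_left volume x₀).comp (b.measurePreserving_repr_symm.comp
      (((EuclideanSpace.volume_preserving_symm_measurableEquiv_toLp (Fin 2)).symm).comp
      ((volume_preserving_finTwoArrow ℝ).symm)))
  · intro z
    change x₀ + b.repr.symm (WithLp.toLp 2 ![z.1, z.2]) = _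
    rw [← b.sum_repr_symm]
    simp [Fin.sum_univ_two, hb1, sub_eq_add_neg, add_assoc]

/-- `T` is the polygon cut out by the tangent lines with unit outer normals `n i` of the disc with
centre `c` and radius `R`, and it is bounded. -/
structure IsCircumscribed {ι : Type*} (T : Set (EuclideanSpace ℝ (Fin 2)))
    (n : ι → EuclideanSpace ℝ (Fin 2)) (c : EuclideanSpace ℝ (Fin 2)) (R : ℝ) : Prop where
  pos : 0 < R
  norm_eq : ∀ i, ‖n i‖ = 1
  injective : Function.Injective n
  -- The normals do not all lie in an open half-plane. This bounds the distance to the nearest side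
  -- by `R`, makes the gauge nonnegative and prevents larger discs.
  balanced : ∀ y, ∃ i, 0 ≤ inner ℝ (n i) y
  mem_iff : ∀ x, x ∈ T ↔ ∀ i, inner ℝ (n i) (x - c) < R
  isBounded : Bornology.IsBounded T

/-- The points of `T` whose nearest side is the `i`-th one. -/
def nearestSide {ι : Type*} (T : Set (EuclideanSpace ℝ (Fin 2)))
    (n : ι → EuclideanSpace ℝ (Fin 2)) (c : EuclideanSpace ℝ (Fin 2)) (i : ι) :
    Set (EuclideanSpace ℝ (Fin 2)) :=
  {x | x ∈ T ∧ ∀ j, inner ℝ (n j) (x - c) ≤ inner ℝ (n i) (x - c)}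

variable {ι : Type*} {T : Set (EuclideanSpace ℝ (Fin 2))}
  {n : ι → EuclideanSpace ℝ (Fin 2)} {c : EuclideanSpace ℝ (Fin 2)} {R : ℝ}

theorem IsCircumscribed.volume_ne_top (h : IsCircumscribed T n c R) : volume T ≠ ⊤ :=
  h.isBounded.measure_lt_top.ne

theorem IsCircumscribed.center_mem (h : IsCircumscribed T n c R) : c ∈ T := by
  rw [h.mem_iff]; simp [h.pos]

/-- Two regions meet inside the line through `c` orthogonal to `n i - n j`, which is nonzero. -/
theorem IsCircumscribed.aedisjoint_nearestSide (h : IsCircumscribed T n c R) :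
    Pairwise (Function.onFun (AEDisjoint volume) (nearestSide T n c)) := by
  intro i j hij
  have hne : n i - n j ≠ 0 := sub_ne_zero.2 fun e => hij (h.injective e)
  set A : AffineSubspace ℝ (EuclideanSpace ℝ (Fin 2)) :=
    AffineSubspace.mk' c (LinearMap.ker (innerSL ℝ (n i - n j) : _ →ₗ[ℝ] ℝ)) with hA
  have hmem : ∀ x, x ∈ A ↔ inner ℝ (n i - n j) (x - c) = 0 := by
    intro x
    rw [hA, AffineSubspace.mem_mk', LinearMap.mem_ker]
    simp [inner_sub_left]
  have hAtop : A ≠ ⊤ := by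
    intro e
    have : n i - n j + c ∈ A := by rw [e]; trivial
    rw [hmem, add_sub_cancel_right, inner_self_eq_zero] at this
    exact hne this
  refine measure_mono_null ?_ (Measure.addHaar_affineSubspace volume A hAtop)
  rintro x ⟨hi, hj⟩
  change x ∈ A
  rw [hmem, inner_sub_left]
  linarith [hi.2 j, hj.2 i]

theorem IsCircumscribed.exists_isTorsionFunction [Nonempty ι] (h : IsCircumscribed T n c R) {p : ℝ}
    (hp : 1 < p) : ∃ u, IsTorsionFunction p T u := by
  obtain ⟨M, hM⟩ := h.isBounded.exists_norm_le
  obtain ⟨i⟩ := ‹Nonempty ι›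
  have hM0 : 0 ≤ M := (norm_nonneg _).trans (hM c h.center_mem)
  refine PTorsion.exists_isTorsionFunction hp h.volume_ne_top (C := (p * M) ^ p) (by positivity)
    fun φ hφ => hφ.poincare hp (h.norm_eq i) fun x hx => ?_
  have := abs_real_inner_le_norm (n i) x
  rw [h.norm_eq, one_mul] at this
  exact this.trans (hM x hx)

variable [Fintype ι]

theorem IsCircumscribed.isOpen (h : IsCircumscribed T n c R) : IsOpen T := by
  have : T = ⋂ i, {x | inner ℝ (n i) (x - c) < R} := by
    ext x; simp [h.mem_iff]
  rw [this]
  exact isOpen_iInter_of_finite fun i => isOpen_lt (by fun_prop) continuous_const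

theorem IsCircumscribed.measurableSet (h : IsCircumscribed T n c R) : MeasurableSet T :=
  h.isOpen.measurableSet

theorem IsCircumscribed.volume_pos (h : IsCircumscribed T n c R) : 0 < volume.real T :=
  ENNReal.toReal_pos (h.isOpen.measure_pos volume ⟨c, h.center_mem⟩).ne' h.volume_ne_top

theorem IsCircumscribed.measurableSet_nearestSide (h : IsCircumscribed T n c R) (i : ι) :
    MeasurableSet (nearestSide T n c i) := by
  have : nearestSide T n c i =
      T ∩ ⋂ j, {x | inner ℝ (n j) (x - c) ≤ inner ℝ (n i) (x - c)} := by
    ext x; simp [nearestSide]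
  rw [this]
  exact h.measurableSet.inter (MeasurableSet.iInter fun j =>
    (isClosed_le (by fun_prop) (by fun_prop)).measurableSet)

theorem IsCircumscribed.iUnion_nearestSide [Nonempty ι] :
    ⋃ i, nearestSide T n c i = T := by
  ext x
  simp only [mem_iUnion]
  refine ⟨fun ⟨i, hi⟩ => hi.1, fun hx => ?_⟩
  obtain ⟨i, hi⟩ := Finite.exists_max fun j => inner ℝ (n j) (x - c)
  exact ⟨i, hx, hi⟩

/-- Moving a distance `d` straight towards side `i` raises `⟨n i, x - c⟩` by `d` and each `⟨n j, x -
c⟩` by at most `d`, as `⟨n j, n i⟩ ≤ 1`; so side `i` stays nearest. Depth is at most `R` because the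
largest of these products is nonnegative. -/
theorem IsCircumscribed.isSubgraph (h : IsCircumscribed T n c R) (i : ι)
    {τ : EuclideanSpace ℝ (Fin 2)} {e : ℝ × ℝ ≃ᵐ EuclideanSpace ℝ (Fin 2)}
    (hτ : inner ℝ (n i) τ = (0 : ℝ)) (he : ∀ z, e z = (c + R • n i) + z.1 • τ - z.2 • n i) :
    IsSubgraph (e ⁻¹' nearestSide T n c i) R := by
  have hi : ∀ s t, inner ℝ (n i) (e (s, t) - c) = R - t := by
    intro s t
    rw [he]
    simp only [inner_sub_right, inner_add_right, inner_smul_right, hτ, real_inner_self_eq_norm_sq,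
      h.norm_eq]
    ring
  refine ⟨e.measurable (h.measurableSet_nearestSide i), fun s t hst => ?_, fun s t hst => ?_,
    fun s t t' hst ht' htt' => ?_⟩
  · have := (h.mem_iff _).1 hst.1 i
    rw [hi] at this
    linarith
  · obtain ⟨j, hj⟩ := h.balanced (e (s, t) - c)
    have := hst.2 j
    rw [hi] at this
    linarith
  · have key : ∀ j, inner ℝ (n j) (e (s, t') - c) ≤ R - t' := by
      intro j
      have h1 : e (s, t') - c = (e (s, t) - c) + (t - t') • n i := by
        rw [he, he]; simp only [sub_smul]; abel
      have h2 := hst.2 j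
      rw [hi] at h2
      have h3 : inner ℝ (n j) (n i) ≤ (1 : ℝ) := by
        have := real_inner_le_norm (n j) (n i)
        rwa [h.norm_eq, h.norm_eq, one_mul] at this
      rw [h1, inner_add_right, inner_smul_right]
      nlinarith
    refine ⟨(h.mem_iff _).2 fun j => (key j).trans_lt (by linarith), fun j => ?_⟩
    rw [hi]
    exact key j

theorem IsCircumscribed.setIntegral_nearestSide_le (h : IsCircumscribed T n c R) (i : ι)
    {φ : EuclideanSpace ℝ (Fin 2) → ℝ} (hφ : IsTestFunction T φ) {p q : ℝ}
    (hpq : p.HolderConjugate q) :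
    ∫ x in nearestSide T n c i, φ x ≤
      (R ^ q * volume.real (nearestSide T n c i) / (q + 1)) ^ (1 / q) *
      (∫ x in nearestSide T n c i, ‖∇ φ x‖ ^ p) ^ (1 / p) := by
  obtain ⟨τ, e, hτ, hem, he⟩ := exists_measurePreserving_coordinates (h.norm_eq i) (c + R • n i)
  have hS := h.isSubgraph i hτ he
  have hmeas := h.measurableSet_nearestSide i
  have hvol : volume (e ⁻¹' nearestSide T n c i) = volume (nearestSide T n c i) :=
    hem.measure_preimage hmeas.nullMeasurableSet
  have hfin : volume (nearestSide T n c i) ≠ ⊤ :=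
    ((measure_mono fun x hx => hx.1).trans_lt h.volume_ne_top.lt_top).ne
  have hec : Continuous e := by
    have : (e : ℝ × ℝ → EuclideanSpace ℝ (Fin 2)) =
        fun z => (c + R • n i) + z.1 • τ - z.2 • n i := funext he
    rw [this]; fun_prop
  have hinner : ∀ x, |inner ℝ (∇ φ x) (-n i)| ≤ ‖∇ φ x‖ := by
    intro x
    have := abs_real_inner_le_norm (∇ φ x) (-n i)
    rwa [norm_neg, h.norm_eq, mul_one] at this
  obtain ⟨C₁, hC₁⟩ := hφ.compact.exists_bound_of_continuous hφ.continuous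
  obtain ⟨C₂, hC₂⟩ :=
    hφ.hasCompactSupport_gradient.exists_bound_of_continuous hφ.continuous_gradient
  have main := hS.setIntegral_le h.pos.le (by rwa [hvol]) (f := fun z => φ (e z))
    (f' := fun z => inner ℝ (∇ φ (e z)) (-n i)) (hφ.continuous.comp hec)
    ((hφ.continuous_gradient.comp hec).inner continuous_const) (fun s t => ?_) (fun s => ?_)
    (C := max C₁ C₂) (fun z => (hC₁ _).trans (le_max_left _ _))
    (fun z => (hinner _).trans ((hC₂ _).trans (le_max_right _ _))) hpq
  · rw [hem.setIntegral_preimage_emb e.measurableEmbedding φ,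
      hem.setIntegral_preimage_emb e.measurableEmbedding fun x => ‖inner ℝ (∇ φ x) (-n i)‖ ^ p,
      Measure.real, hvol] at main
    refine main.trans (mul_le_mul_of_nonneg_left ?_ ?_)
    · refine Real.rpow_le_rpow (integral_nonneg fun x => Real.rpow_nonneg (norm_nonneg _) _)
        (integral_mono_of_nonneg (.of_forall fun x => Real.rpow_nonneg (norm_nonneg _) _) ?_
          (.of_forall fun x => Real.rpow_le_rpow (norm_nonneg _) (hinner x) hpq.nonneg))
        (one_div_nonneg.2 hpq.nonneg)
      have h1 := integrable_norm_rpow hpq.lt (hφ.memLp_gradient (ENNReal.ofReal p))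
      exact IntegrableOn.mono_set (t := T) h1 fun x hx => hx.1
    · have := hpq.symm.pos
      have := h.pos
      exact Real.rpow_nonneg (by positivity) _
  · have h1 : HasDerivAt (fun t : ℝ => e (s, t)) (-n i) t := by
      simp only [he]
      simpa using ((hasDerivAt_id t).smul_const (n i)).const_sub (c + R • n i + s • τ)
    have h2 := (hφ.differentiable (e (s, t))).hasFDerivAt.comp_hasDerivAt t h1
    rwa [← inner_gradient_left] at h2
  -- At depth `0` the point lies on the tangent line, hence outside the open set `T`.
  · refine hφ.eq_zero fun hx => ?_
    have h1 := (h.mem_iff _).1 hx i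
    rw [he] at h1
    simp only [inner_sub_right, inner_add_right, inner_smul_right, hτ, real_inner_self_eq_norm_sq,
      h.norm_eq] at h1
    linarith

/-- The Hersch–Makai type inequality for test functions on a circumscribed polygon. -/
theorem IsCircumscribed.integral_test_le [Nonempty ι] (h : IsCircumscribed T n c R)
    {φ : EuclideanSpace ℝ (Fin 2) → ℝ} (hφ : IsTestFunction T φ) {p q : ℝ}
    (hpq : p.HolderConjugate q) :
    ∫ x in T, φ x ≤ (R ^ q * volume.real T / (q + 1)) ^ (1 / q) *
      (∫ x in T, ‖∇ φ x‖ ^ p) ^ (1 / p) := by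
  have split : ∀ {f : EuclideanSpace ℝ (Fin 2) → ℝ}, IntegrableOn f T →
      ∫ x in T, f x = ∑ i, ∫ x in nearestSide T n c i, f x := by
    intro f hf
    have hU := IsCircumscribed.iUnion_nearestSide (T := T) (n := n) (c := c)
    rw [← tsum_fintype (L := .unconditional _), ← integral_iUnion_ae
      (fun i => (h.measurableSet_nearestSide i).nullMeasurableSet) h.aedisjoint_nearestSide
      (by rwa [hU]), hU]
  have s0 : volume.real T = ∑ i, volume.real (nearestSide T n c i) := by
    have := split (f := fun _ => 1) (by simp [h.volume_ne_top.lt_top])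
    simpa using this
  have i1 : IntegrableOn (fun x => ‖∇ φ x‖ ^ p) T :=
    integrable_norm_rpow hpq.lt (hφ.memLp_gradient (ENNReal.ofReal p))
  have hp := hpq.pos
  have hq := hpq.symm.pos
  have hR := h.pos
  have n1 : ∀ i, 0 ≤ R ^ q * volume.real (nearestSide T n c i) / (q + 1) := fun i => by positivity
  have n2 : ∀ i, 0 ≤ ∫ x in nearestSide T n c i, ‖∇ φ x‖ ^ p := fun i =>
    integral_nonneg fun x => Real.rpow_nonneg (norm_nonneg _) _
  rw [split (memLp_one_iff_integrable.1 (hφ.memLp 1)), split i1, s0]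
  refine (Finset.sum_le_sum fun i _ => h.setIntegral_nearestSide_le i hφ hpq).trans ?_
  -- Hölder for the finite sum over sides reassembles the areas and the gradient integrals without
  -- loss.
  refine (Real.inner_le_Lp_mul_Lq_of_nonneg Finset.univ hpq.symm
    (fun i _ => Real.rpow_nonneg (n1 i) _) (fun i _ => Real.rpow_nonneg (n2 i) _)).trans
    (le_of_eq ?_)
  have e1 : ∀ i, ((R ^ q * volume.real (nearestSide T n c i) / (q + 1)) ^ (1 / q)) ^ q =
      R ^ q * volume.real (nearestSide T n c i) / (q + 1) := fun i => by
    rw [← Real.rpow_mul (n1 i), one_div_mul_cancel hq.ne', Real.rpow_one]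
  have e2 : ∀ i, ((∫ x in nearestSide T n c i, ‖∇ φ x‖ ^ p) ^ (1 / p)) ^ p =
      ∫ x in nearestSide T n c i, ‖∇ φ x‖ ^ p := fun i => by
    rw [← Real.rpow_mul (n2 i), one_div_mul_cancel hp.ne', Real.rpow_one]
  simp only [e1, e2]
  rw [← Finset.sum_div, ← Finset.mul_sum]

theorem IsCircumscribed.integral_torsion_le [Nonempty ι] (h : IsCircumscribed T n c R) {p : ℝ}
    (hp : 1 < p) {u : EuclideanSpace ℝ (Fin 2) → ℝ} (hu : IsTorsionFunction p T u) :
    ∫ x in T, u x ≤ R ^ p.conjExponent * volume.real T / (p.conjExponent + 1) := by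
  have hpq := Real.HolderConjugate.conjExponent hp
  have := h.pos
  have := hpq.symm.pos
  refine hu.integral_le hp h.volume_ne_top (by positivity) fun φ hφ => ?_
  have e : 1 - 1 / p = 1 / p.conjExponent := by
    have := hpq.one_sub_inv
    rw [one_div, one_div, this]
  rw [e]
  exact h.integral_test_le hφ hpq

end UpperBound

/-! ### A smooth truncation -/

section Cutoff

/-- A smooth `1`-Lipschitz approximation of the positive part that vanishes on `(-∞, δ]`. -/
theorem exists_smooth_posPart {δ : ℝ} (hδ : 0 < δ) : ∃ Θ : ℝ → ℝ, ContDiff ℝ ∞ Θ ∧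
    (∀ t ≤ δ, Θ t = 0) ∧ (∀ t, t - 2 * δ ≤ Θ t) ∧ ∀ t, |deriv Θ t| ≤ 1 := by
  -- The slope of `Θ`: it is `0` up to `δ` and `1` from `2 * δ` on, so the primitive loses at most
  -- `2 * δ`.
  set σ : ℝ → ℝ := fun s => Real.smoothTransition ((s - δ) / δ) with hσ
  have hσc : ContDiff ℝ ∞ σ := Real.smoothTransition.contDiff.comp (by fun_prop)
  have hσ0 : ∀ s, 0 ≤ σ s := fun s => Real.smoothTransition.nonneg _
  have hσ1 : ∀ s, σ s ≤ 1 := fun s => Real.smoothTransition.le_one _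
  have hσz : ∀ s ≤ δ, σ s = 0 := fun s hs =>
    Real.smoothTransition.zero_of_nonpos (div_nonpos_of_nonpos_of_nonneg (by linarith) hδ.le)
  have hσo : ∀ s, 2 * δ ≤ s → σ s = 1 := fun s hs =>
    Real.smoothTransition.one_of_one_le ((one_le_div hδ).2 (by linarith))
  have hint : ∀ a b, IntervalIntegrable σ volume a b := fun a b =>
    hσc.continuous.intervalIntegrable a b
  set Θ : ℝ → ℝ := fun t => ∫ s in (0)..t, σ s with hΘ
  have hd : ∀ t, HasDerivAt Θ (σ t) t := fun t => hσc.continuous.integral_hasStrictDerivAt 0 t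
    |>.hasDerivAt
  have hderiv : deriv Θ = σ := funext fun t => (hd t).deriv
  have hz : ∀ t ≤ δ, Θ t = 0 := by
    intro t ht
    refine intervalIntegral.integral_zero_ae (.of_forall fun s hs => hσz s ?_)
    rw [uIoc] at hs
    exact hs.2.trans (max_le hδ.le ht)
  refine ⟨Θ, contDiff_infty_iff_deriv.2 ⟨fun t => (hd t).differentiableAt, hderiv ▸ hσc⟩, hz,
    fun t => ?_, fun t => ?_⟩
  · rcases le_total t (2 * δ) with ht | ht
    · have : 0 ≤ Θ t := by
        rcases le_total t δ with h | h
        · rw [hz t h]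
        · exact intervalIntegral.integral_nonneg (hδ.le.trans h) fun s _ => hσ0 s
      linarith
    · have h1 : Θ t = (∫ s in (0)..(2 * δ), σ s) + ∫ s in (2 * δ)..t, σ s :=
        (intervalIntegral.integral_add_adjacent_intervals (hint _ _) (hint _ _)).symm
      have h2 : 0 ≤ ∫ s in (0)..(2 * δ), σ s :=
        intervalIntegral.integral_nonneg (by linarith) fun s _ => hσ0 s
      have h3 : ∫ s in (2 * δ)..t, σ s = t - 2 * δ := by
        rw [intervalIntegral.integral_congr (g := fun _ => 1) fun s hs => ?_]
        · simp
        · rw [uIcc_of_le ht] at hs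
          exact hσo s hs.1
      linarith
  · rw [hderiv, abs_of_nonneg (hσ0 t)]
    exact hσ1 t

end Cutoff

/-! ### The gauge about the incentre and its smoothing -/

section Gauge

/-- The gauge of the circumscribed polygon with respect to its incentre. -/
def polygonGauge {ι : Type*} (n : ι → EuclideanSpace ℝ (Fin 2)) (c : EuclideanSpace ℝ (Fin 2))
    (R : ℝ) (x : EuclideanSpace ℝ (Fin 2)) : ℝ :=
  ⨆ i, inner ℝ (n i) (x - c) / R

variable {ι : Type*} [Fintype ι] {T : Set (EuclideanSpace ℝ (Fin 2))}
  {n : ι → EuclideanSpace ℝ (Fin 2)} {c : EuclideanSpace ℝ (Fin 2)} {R : ℝ}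

theorem le_polygonGauge (x : EuclideanSpace ℝ (Fin 2)) (i : ι) :
    inner ℝ (n i) (x - c) / R ≤ polygonGauge n c R x :=
  le_ciSup (f := fun i => inner ℝ (n i) (x - c) / R) (Finite.bddAbove_range _) i

theorem exists_eq_polygonGauge [Nonempty ι] (x : EuclideanSpace ℝ (Fin 2)) :
    ∃ i, inner ℝ (n i) (x - c) / R = polygonGauge n c R x :=
  exists_eq_ciSup_of_finite

theorem IsCircumscribed.polygonGauge_nonneg (h : IsCircumscribed T n c R)
    (x : EuclideanSpace ℝ (Fin 2)) : 0 ≤ polygonGauge n c R x := by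
  obtain ⟨i, hi⟩ := h.balanced (x - c)
  exact (div_nonneg hi h.pos.le).trans (le_polygonGauge x i)

theorem measurable_polygonGauge : Measurable (polygonGauge n c R) :=
  Measurable.iSup fun i => by fun_prop

theorem polygonGauge_lt_iff [Nonempty ι] {x : EuclideanSpace ℝ (Fin 2)} {s : ℝ} :
    polygonGauge n c R x < s ↔ ∀ i, inner ℝ (n i) (x - c) / R < s := by
  refine ⟨fun hx i => (le_polygonGauge x i).trans_lt hx, fun hx => ?_⟩
  obtain ⟨i, hi⟩ := exists_eq_polygonGauge (n := n) (c := c) (R := R) x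
  exact hi ▸ hx i

theorem IsCircumscribed.mem_iff_polygonGauge [Nonempty ι] (h : IsCircumscribed T n c R)
    (x : EuclideanSpace ℝ (Fin 2)) : x ∈ T ↔ polygonGauge n c R x < 1 := by
  simp only [h.mem_iff, polygonGauge_lt_iff, div_lt_one h.pos]

/-- The sublevel set is the image of `T` under the homothety of ratio `s` about `c`; the exponent is
the dimension. -/
theorem IsCircumscribed.volume_polygonGauge_lt [Nonempty ι] (h : IsCircumscribed T n c R) {s : ℝ}
    (hs : 0 < s) : volume.real {x | polygonGauge n c R x < s} = s ^ 2 * volume.real T := by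
  have : {x | polygonGauge n c R x < s} = AffineMap.homothety c s '' T := by
    ext x
    simp only [mem_ofPred_eq, mem_image, AffineMap.homothety_apply, vsub_eq_sub, vadd_eq_add]
    constructor
    · intro hx
      refine ⟨c + s⁻¹ • (x - c), (h.mem_iff _).2 fun i => ?_, ?_⟩
      · have := polygonGauge_lt_iff.1 hx i
        rw [div_lt_iff₀ h.pos] at this
        rw [add_sub_cancel_left, inner_smul_right, inv_mul_lt_iff₀ hs]
        exact this
      · rw [add_sub_cancel_left, smul_smul, mul_inv_cancel₀ hs.ne', one_smul]
        abel
    · rintro ⟨y, hy, rfl⟩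
      refine polygonGauge_lt_iff.2 fun i => ?_
      rw [add_sub_cancel_right, inner_smul_right, div_lt_iff₀ h.pos]
      exact mul_lt_mul_of_pos_left ((h.mem_iff y).1 hy i) hs
  rw [this, Measure.real, Measure.addHaar_image_homothety, ENNReal.toReal_mul,
    ENNReal.toReal_ofReal (abs_nonneg _)]
  simp [Measure.real]

/-- Layer cake: in `T` the set where `g ^ q ≥ t` has area `V * (1 - t ^ (2 / q))` for `0 < t ≤ 1`.
-/
theorem IsCircumscribed.integral_polygonGauge_rpow [Nonempty ι] (h : IsCircumscribed T n c R)
    {q : ℝ} (hq : 0 < q) :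
    ∫ x in T, polygonGauge n c R x ^ q = volume.real T * (2 / (q + 2)) := by
  have hfin : IsFiniteMeasure (volume.restrict T) :=
    ⟨by simpa [lt_top_iff_ne_top] using h.volume_ne_top⟩
  have hg0 := h.polygonGauge_nonneg
  have hmeas : Measurable fun x => polygonGauge n c R x ^ q := measurable_polygonGauge.pow_const q
  have hint : Integrable (fun x => polygonGauge n c R x ^ q) (volume.restrict T) :=
    integrableOn_of_bounded (C := 1) h.measurableSet h.volume_ne_top hmeas.aestronglyMeasurable
      fun x hx => by
        rw [abs_of_nonneg (Real.rpow_nonneg (hg0 x) _)]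
        exact Real.rpow_le_one (hg0 x) ((h.mem_iff_polygonGauge x).1 hx).le hq.le
  have hsec : ∀ t ∈ Ioi (0 : ℝ), (volume.restrict T).real {x | t ≤ polygonGauge n c R x ^ q} =
      (Ioc (0 : ℝ) 1).indicator (fun t => volume.real T * (1 - t ^ (2 / q))) t := by
    intro t ht
    rw [measureReal_restrict_apply (measurableSet_le measurable_const hmeas)]
    by_cases ht1 : t ≤ 1
    · rw [indicator_of_mem (show t ∈ Ioc (0 : ℝ) 1 from ⟨ht, ht1⟩)]
      have hs : 0 < t ^ q⁻¹ := Real.rpow_pos_of_pos ht _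
      have e : {x | t ≤ polygonGauge n c R x ^ q} ∩ T =
          T \ {x | polygonGauge n c R x < t ^ q⁻¹} := by
        ext x
        simp only [mem_inter_iff, mem_ofPred_eq, Set.mem_sdiff, not_lt]
        rw [Real.rpow_inv_le_iff_of_pos ht.le (hg0 x) hq, and_comm]
      have hsub : {x | polygonGauge n c R x < t ^ q⁻¹} ⊆ T := fun x hx =>
        (h.mem_iff_polygonGauge x).2
          (lt_of_lt_of_le hx (Real.rpow_le_one ht.le ht1 (by positivity)))
      rw [e, measureReal_sdiff hsub (measurableSet_lt measurable_polygonGauge measurable_const)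
        h.volume_ne_top, h.volume_polygonGauge_lt hs, ← Real.rpow_natCast, ← Real.rpow_mul ht.le]
      have : q⁻¹ * ((2 : ℕ) : ℝ) = 2 / q := by push_cast; field_simp
      rw [this]; ring
    · rw [indicator_of_notMem (fun hh => ht1 hh.2)]
      have e : {x | t ≤ polygonGauge n c R x ^ q} ∩ T = ∅ := by
        refine eq_empty_iff_forall_notMem.2 fun x hx => ht1 (hx.1.trans ?_)
        exact Real.rpow_le_one (hg0 x) ((h.mem_iff_polygonGauge x).1 hx.2).le hq.le
      simp [e]
  rw [hint.integral_eq_integral_meas_le (.of_forall fun x => Real.rpow_nonneg (hg0 x) _),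
    setIntegral_congr_fun measurableSet_Ioi hsec, setIntegral_indicator measurableSet_Ioc,
    inter_eq_self_of_subset_right Ioc_subset_Ioi_self, ← intervalIntegral.integral_of_le zero_le_one,
    intervalIntegral.integral_const_mul, intervalIntegral.integral_sub (by simp)
      (intervalIntegral.intervalIntegrable_rpow' (by
        have : 0 < 2 / q := by positivity
        linarith)),
    integral_rpow (Or.inl (by
        have : 0 < 2 / q := by positivity
        linarith))]
  have h1 : (2 : ℝ) / q + 1 ≠ 0 := by positivity
  rw [Real.one_rpow, Real.zero_rpow h1]
  simp only [intervalIntegral.integral_const]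
  norm_num
  left
  field_simp
  ring

/-- A smooth approximation of the gauge from above with the same Lipschitz constant. -/
theorem IsCircumscribed.exists_smooth_gauge [Nontrivial ι] (h : IsCircumscribed T n c R) {ε : ℝ}
    (hε : 0 < ε) : ∃ M : EuclideanSpace ℝ (Fin 2) → ℝ, ContDiff ℝ ∞ M ∧ (∀ x, 0 < M x) ∧
      (∀ x, polygonGauge n c R x ≤ M x) ∧ (∀ x, M x ≤ polygonGauge n c R x + ε) ∧
      ∀ x, ‖fderiv ℝ M x‖ ≤ 1 / R := by
  have hR := h.pos
  have hcard : (1 : ℝ) < Fintype.card ι := by exact_mod_cast Fintype.one_lt_card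
  set L := Real.log (Fintype.card ι) with hL
  have hLpos : 0 < L := Real.log_pos hcard
  -- Log-sum-exp at inverse temperature `k` exceeds the maximum of `N` terms by at most `log N / k`,
  -- which is `ε` here.
  set k := L / ε with hk
  have hkpos : 0 < k := by positivity
  set S : EuclideanSpace ℝ (Fin 2) → ℝ := fun x =>
    ∑ i, Real.exp (k * (inner ℝ (n i) (x - c) / R)) with hS
  have hSpos : ∀ x, 0 < S x := fun x => Finset.sum_pos (fun i _ => Real.exp_pos _)
    Finset.univ_nonempty
  have hterm : ∀ x i, Real.exp (k * (inner ℝ (n i) (x - c) / R)) ≤ S x := fun x i =>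
    Finset.single_le_sum (f := fun i => Real.exp (k * (inner ℝ (n i) (x - c) / R)))
      (fun i _ => (Real.exp_pos _).le) (Finset.mem_univ i)
  have hSsmooth : ContDiff ℝ ∞ S := by
    refine ContDiff.sum fun i _ => Real.contDiff_exp.comp ?_
    exact contDiff_const.mul ((contDiff_const.inner ℝ (contDiff_id.sub contDiff_const)).div_const R)
  refine ⟨fun x => Real.log (S x) / k, (hSsmooth.log fun x => (hSpos x).ne').div_const k,
    fun x => ?_, fun x => ?_, fun x => ?_, fun x => ?_⟩
  -- One exponential is at least `1` and a second one is positive, so `S x > 1`. Strict positivity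
  -- keeps `M ^ q` smooth later on.
  · obtain ⟨i, hi⟩ := h.balanced (x - c)
    obtain ⟨j, hj⟩ := exists_ne i
    refine div_pos (Real.log_pos ?_) hkpos
    have h1 : 1 ≤ Real.exp (k * (inner ℝ (n i) (x - c) / R)) := Real.one_le_exp (by positivity)
    have h2 := Finset.add_le_sum (f := fun i => Real.exp (k * (inner ℝ (n i) (x - c) / R)))
      (fun i _ => (Real.exp_pos _).le) (Finset.mem_univ i) (Finset.mem_univ j) hj.symm
    have h3 := Real.exp_pos (k * (inner ℝ (n j) (x - c) / R))
    linarith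
  · obtain ⟨i, hi⟩ := exists_eq_polygonGauge (n := n) (c := c) (R := R) x
    rw [← hi, le_div_iff₀ hkpos, Real.le_log_iff_exp_le (hSpos x), mul_comm]
    exact hterm x i
  · rw [div_le_iff₀ hkpos, Real.log_le_iff_le_exp (hSpos x)]
    have h1 : ε * k = L := by rw [hk]; field_simp
    rw [add_mul, h1, Real.exp_add, hL, Real.exp_log (by linarith)]
    calc S x ≤ ∑ _i : ι, Real.exp (polygonGauge n c R x * k) := by
          refine Finset.sum_le_sum fun i _ => Real.exp_le_exp.2 ?_
          rw [mul_comm]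
          exact mul_le_mul_of_nonneg_right (le_polygonGauge x i) hkpos.le
      _ = _ := by simp [mul_comm]
  · have hd : HasFDerivAt S (∑ i, Real.exp (k * (inner ℝ (n i) (x - c) / R)) •
        ((k / R) • innerSL ℝ (n i))) x := by
      refine HasFDerivAt.fun_sum fun i _ => HasFDerivAt.exp ?_
      have h1 : HasFDerivAt (fun x => innerSL ℝ (n i) (x - c)) (innerSL ℝ (n i)) x :=
        (innerSL ℝ (n i)).hasFDerivAt.comp x ((hasFDerivAt_id x).sub_const c)
      have h2 := h1.const_mul (k / R)
      refine h2.congr_of_eventuallyEq (.of_forall fun y => ?_)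
      simp only [innerSL_apply_apply]
      ring
    have hM := (hd.log (hSpos x).ne').mul_const k⁻¹
    simp only [← div_eq_mul_inv] at hM
    rw [hM.fderiv, norm_smul, norm_smul, Real.norm_of_nonneg (by positivity),
      Real.norm_of_nonneg (by have := hSpos x; positivity)]
    -- The derivative is a convex combination of the covectors `n i / R`, each of norm `1 / R`.
    have hnorm : ‖∑ i, Real.exp (k * (inner ℝ (n i) (x - c) / R)) •
        ((k / R) • innerSL ℝ (n i))‖ ≤ S x * (k / R) := by
      rw [hS, Finset.sum_mul]
      refine norm_sum_le_of_le _ fun i _ => ?_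
      rw [norm_smul, norm_smul, innerSL_apply_norm, h.norm_eq, mul_one, Real.norm_of_nonneg
        (Real.exp_pos _).le, Real.norm_of_nonneg (by positivity)]
    calc k⁻¹ * ((S x)⁻¹ * _) ≤ k⁻¹ * ((S x)⁻¹ * (S x * (k / R))) := by
          have := hSpos x
          gcongr
      _ = 1 / R := by
          have := (hSpos x).ne'
          field_simp

end Gauge

/-! ### Lower bound from the Rayleigh quotient of `1 - g ^ q` -/

section LowerBound

variable {ι : Type*} [Fintype ι] [Nontrivial ι] {T : Set (EuclideanSpace ℝ (Fin 2))}
  {n : ι → EuclideanSpace ℝ (Fin 2)} {c : EuclideanSpace ℝ (Fin 2)} {R : ℝ}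

/-- A regularisation of `1 - g ^ q`: the gauge is replaced by a smooth positive majorant and the
result is truncated to compact support in `T`. The relation `(q - 1) * p = q` turns the `p`-th power
of the gradient back into `g ^ q`. -/
theorem IsCircumscribed.exists_testFunction (h : IsCircumscribed T n c R) {p q : ℝ}
    (hpq : p.HolderConjugate q) {ε : ℝ} (hε : 0 < ε) :
    ∃ φ, IsTestFunction T φ ∧ (∀ x, 1 - (polygonGauge n c R x + ε) ^ q - ε ≤ φ x) ∧
      ∀ x, ‖∇ φ x‖ ^ p ≤ (q / R) ^ p * (polygonGauge n c R x + ε) ^ q := by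
  have hq := hpq.symm.pos
  have hp := hpq.pos
  have hR := h.pos
  have hq1 : 0 < q - 1 := by linarith [hpq.symm.lt]
  obtain ⟨M, hMs, hM0, hMg, hMe, hMd⟩ := h.exists_smooth_gauge hε
  obtain ⟨Θ, hΘs, hΘz, hΘl, hΘd⟩ := exists_smooth_posPart (half_pos hε)
  have hMq : ∀ x, M x ^ q ≤ (polygonGauge n c R x + ε) ^ q := fun x =>
    Real.rpow_le_rpow (hM0 x).le (hMe x) hq.le
  have hMqs : ContDiff ℝ ∞ fun x => 1 - M x ^ q :=
    contDiff_const.sub (hMs.rpow_const_of_ne fun x => (hM0 x).ne')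
  have hsupp : tsupport (fun x => Θ (1 - M x ^ q)) ⊆ {x | ε / 2 ≤ 1 - M x ^ q} := by
    refine closure_minimal (fun x hx => ?_) (isClosed_le continuous_const hMqs.continuous)
    by_contra hc
    exact hx (hΘz _ (not_le.1 hc).le)
  have hsub : tsupport (fun x => Θ (1 - M x ^ q)) ⊆ T := fun x hx => by
    have h1 : ε / 2 ≤ 1 - M x ^ q := hsupp hx
    rw [h.mem_iff_polygonGauge]
    refine (hMg x).trans_lt ?_
    by_contra! hc
    have := Real.one_le_rpow hc hq.le
    linarith
  refine ⟨fun x => Θ (1 - M x ^ q), ⟨hΘs.comp hMqs, ?_, hsub⟩, fun x => ?_, fun x => ?_⟩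
  · exact Metric.isCompact_of_isClosed_isBounded (isClosed_tsupport _) (h.isBounded.subset hsub)
  · have h1 := hΘl (1 - M x ^ q)
    have h2 := hMq x
    linarith
  · have hd1 : HasFDerivAt M (fderiv ℝ M x) x :=
      (hMs.differentiable (by simp) x).hasFDerivAt
    have hd2 : HasFDerivAt (fun x => 1 - M x ^ q) (-((q * M x ^ (q - 1)) • fderiv ℝ M x)) x :=
      (hd1.rpow_const (Or.inl (hM0 x).ne')).const_sub 1
    have hd3 : HasFDerivAt (fun x => Θ (1 - M x ^ q)) _ x :=
      (hΘs.differentiable (by simp) (1 - M x ^ q)).hasDerivAt.comp_hasFDerivAt x hd2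
    have h1 : ‖∇ (fun x => Θ (1 - M x ^ q)) x‖ ≤ q / R * M x ^ (q - 1) := by
      have hMp : 0 ≤ M x ^ (q - 1) := Real.rpow_nonneg (hM0 x).le _
      have e : ‖∇ (fun x => Θ (1 - M x ^ q)) x‖ = ‖fderiv ℝ (fun x => Θ (1 - M x ^ q)) x‖ := by
        simp [gradient]
      have hqM : 0 ≤ q * M x ^ (q - 1) := mul_nonneg hq.le hMp
      rw [e, hd3.fderiv, norm_smul, norm_neg, norm_smul, Real.norm_of_nonneg hqM,
        Real.norm_eq_abs]
      calc _ ≤ 1 * (q * M x ^ (q - 1) * (1 / R)) := by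
            refine mul_le_mul (hΘd _) ?_ (by positivity) zero_le_one
            exact mul_le_mul_of_nonneg_left (hMd x) hqM
        _ = _ := by ring
    have h2 := Real.rpow_le_rpow (norm_nonneg _) h1 hp.le
    rw [Real.mul_rpow (by positivity) (Real.rpow_nonneg (hM0 x).le _),
      ← Real.rpow_mul (hM0 x).le] at h2
    have h3 : (q - 1) * p = q := by
      have := hpq.symm.sub_one_mul_conj
      linarith
    rw [h3] at h2
    exact h2.trans (mul_le_mul_of_nonneg_left (hMq x) (by positivity))

theorem IsCircumscribed.tendsto_integral_polygonGauge_rpow (h : IsCircumscribed T n c R)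
    {q : ℝ} (hq : 0 < q) :
    Tendsto (fun k : ℕ => ∫ x in T, (polygonGauge n c R x + 1 / ((k : ℝ) + 1)) ^ q) atTop
      (𝓝 (volume.real T * (2 / (q + 2)))) := by
  rw [← h.integral_polygonGauge_rpow hq]
  have hfin : IsFiniteMeasure (volume.restrict T) :=
    ⟨by simpa [lt_top_iff_ne_top] using h.volume_ne_top⟩
  have hk : ∀ k : ℕ, 0 ≤ 1 / ((k : ℝ) + 1) ∧ 1 / ((k : ℝ) + 1) ≤ 1 := fun k =>
    ⟨by positivity, by rw [div_le_one (by positivity)]; linarith [Nat.cast_nonneg (α := ℝ) k]⟩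
  refine tendsto_integral_of_dominated_convergence (fun _ => (2 : ℝ) ^ q)
    (fun k => ((measurable_polygonGauge.add_const _).pow_const q).aestronglyMeasurable)
    (integrable_const _) (fun k => ?_) (.of_forall fun x => ?_)
  · refine (ae_restrict_iff' h.measurableSet).2 (.of_forall fun x hx => ?_)
    have h1 := h.polygonGauge_nonneg x
    have h2 := (h.mem_iff_polygonGauge x).1 hx
    rw [Real.norm_of_nonneg (Real.rpow_nonneg (add_nonneg h1 (hk k).1) _)]
    exact Real.rpow_le_rpow (add_nonneg h1 (hk k).1) (by linarith [(hk k).2]) hq.le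
  · have := (tendsto_one_div_add_atTop_nhds_zero_nat (𝕜 := ℝ)).const_add (polygonGauge n c R x)
    rw [add_zero] at this
    exact this.rpow_const (Or.inr hq.le)

/-- Formally, `1 - g ^ q` inserted in the Rayleigh bound; the limit `ε = 1 / (k + 1) → 0` justifies
it. -/
theorem IsCircumscribed.le_integral_torsion (h : IsCircumscribed T n c R) {p : ℝ}
    (hp : 1 < p) {u : EuclideanSpace ℝ (Fin 2) → ℝ} (hu : IsTorsionFunction p T u) :
    volume.real T * (p.conjExponent / (p.conjExponent + 2)) ≤
      (∫ x in T, u x) ^ (1 - 1 / p) *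
        ((p.conjExponent / R) ^ p * (volume.real T * (2 / (p.conjExponent + 2)))) ^ (1 / p) := by
  have hpq := Real.HolderConjugate.conjExponent hp
  set q := p.conjExponent
  have hq := hpq.symm.pos
  have hR := h.pos
  have hfin : IsFiniteMeasure (volume.restrict T) :=
    ⟨by simpa [lt_top_iff_ne_top] using h.volume_ne_top⟩
  set a : ℕ → ℝ := fun k => ∫ x in T, (polygonGauge n c R x + 1 / ((k : ℝ) + 1)) ^ q with ha
  have hlim : Tendsto a atTop _ := h.tendsto_integral_polygonGauge_rpow hq
  have hε : ∀ k : ℕ, 0 < 1 / ((k : ℝ) + 1) := fun k => by positivity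
  have hI : 0 ≤ ∫ x in T, u x := by
    obtain ⟨G, -, hG, -⟩ := hu.exists_energy_identity hp h.volume_ne_top
    rw [← hG]
    exact integral_nonneg fun x => Real.rpow_nonneg (norm_nonneg _) _
  have hint : ∀ k : ℕ, Integrable (fun x => (polygonGauge n c R x + 1 / ((k : ℝ) + 1)) ^ q)
      (volume.restrict T) := fun k =>
    integrableOn_of_bounded (C := (1 + 1 / ((k : ℝ) + 1)) ^ q) h.measurableSet h.volume_ne_top
      ((measurable_polygonGauge.add_const _).pow_const q).aestronglyMeasurable fun x hx => by
        have h1 := h.polygonGauge_nonneg x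
        have h2 := (h.mem_iff_polygonGauge x).1 hx
        have h3 := (hε k).le
        rw [abs_of_nonneg (by positivity)]
        gcongr
  have hbound : ∀ k, volume.real T - a k - 1 / ((k : ℝ) + 1) * volume.real T ≤
      (∫ x in T, u x) ^ (1 - 1 / p) * ((q / R) ^ p * a k) ^ (1 / p) := by
    intro k
    obtain ⟨φ, hφ, hφ1, hφ2⟩ := h.exists_testFunction hpq (hε k)
    have h1 : volume.real T - a k - 1 / ((k : ℝ) + 1) * volume.real T ≤ ∫ x in T, φ x := by
      have e : volume.real T - a k - 1 / ((k : ℝ) + 1) * volume.real T =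
          ∫ x in T, (1 - (polygonGauge n c R x + 1 / ((k : ℝ) + 1)) ^ q - 1 / ((k : ℝ) + 1)) := by
        have i1 : Integrable (fun x => 1 - (polygonGauge n c R x + 1 / ((k : ℝ) + 1)) ^ q)
          (volume.restrict T) := (integrable_const 1).sub (hint k)
        rw [integral_sub i1 (integrable_const _), integral_sub (integrable_const 1) (hint k)]
        simp [ha, mul_comm]
      rw [e]
      exact integral_mono (((integrable_const 1).sub (hint k)).sub (integrable_const _))
        (memLp_one_iff_integrable.1 (hφ.memLp 1)) hφ1
    refine h1.trans ((hu.integral_test_le hp h.volume_ne_top hφ).trans ?_)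
    refine mul_le_mul_of_nonneg_left (Real.rpow_le_rpow
      (integral_nonneg fun x => Real.rpow_nonneg (norm_nonneg _) _) ?_
      (one_div_nonneg.2 hpq.nonneg)) (Real.rpow_nonneg hI _)
    rw [ha, ← integral_const_mul]
    exact integral_mono (integrable_norm_rpow hp (hφ.memLp_gradient (ENNReal.ofReal p)))
      ((hint k).const_mul _) hφ2
  have hl := ((hlim.const_sub (volume.real T)).sub
    ((tendsto_one_div_add_atTop_nhds_zero_nat (𝕜 := ℝ)).mul_const (volume.real T)))
  have hr := ((hlim.const_mul ((q / R) ^ p)).rpow_const (p := 1 / p)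
    (Or.inr (one_div_nonneg.2 hpq.nonneg))).const_mul ((∫ x in T, u x) ^ (1 - 1 / p))
  refine (le_of_eq ?_).trans (le_of_tendsto_of_tendsto' hl hr hbound)
  field_simp
  ring

end LowerBound

/-! ### Two-sided bounds for the rigidity and for `Q` -/

section Bounds

variable {ι : Type*} [Fintype ι] [Nontrivial ι] {T : Set (EuclideanSpace ℝ (Fin 2))}
  {n : ι → EuclideanSpace ℝ (Fin 2)} {c : EuclideanSpace ℝ (Fin 2)} {R : ℝ}

theorem IsCircumscribed.torsionalRigidity_bounds (h : IsCircumscribed T n c R) {p : ℝ}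
    (hp : 1 < p) :
    0 < torsionalRigidity p T ∧
    torsionalRigidity p T ^ (p - 1) ≤
      volume.real T ^ (p - 1) * R ^ p / (p.conjExponent + 1) ^ (p - 1) ∧
    volume.real T ^ (p - 1) * R ^ p ≤
      2 * (p.conjExponent + 2) ^ (p - 1) * torsionalRigidity p T ^ (p - 1) := by
  have hex := h.exists_isTorsionFunction hp
  have hpq := Real.HolderConjugate.conjExponent hp
  have e0 : torsionalRigidity p T = ∫ x in T, hex.choose x := by
    rw [torsionalRigidity, dif_pos hex]
  have hup := h.integral_torsion_le hp hex.choose_spec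
  have hlo := h.le_integral_torsion hp hex.choose_spec
  rw [← e0] at hup hlo
  set I := torsionalRigidity p T
  set q := p.conjExponent
  have hq := hpq.symm.pos
  have hp0 := hpq.pos
  have hR := h.pos
  have hV := h.volume_pos
  set V := volume.real T
  have hp1 : 0 < p - 1 := by linarith
  have he : 0 < 1 - 1 / p := by rw [sub_pos, div_lt_one hp0]; exact hp
  have hI0 : 0 ≤ I := by
    rw [e0]
    obtain ⟨G, -, hG, -⟩ := hex.choose_spec.exists_energy_identity hp h.volume_ne_top
    rw [← hG]
    exact integral_nonneg fun x => Real.rpow_nonneg (norm_nonneg _) _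
  -- If `I` were `0`, the right side of the lower bound would vanish while its left side is
  -- positive.
  have hI : 0 < I := by
    rcases hI0.eq_or_lt with h0 | h0
    · rw [← h0, Real.zero_rpow he.ne', zero_mul] at hlo
      have : 0 < V * (q / (q + 2)) := by positivity
      linarith
    · exact h0
  refine ⟨hI, ?_, ?_⟩
  · have h1 := Real.rpow_le_rpow hI0 hup hp1.le
    rw [Real.div_rpow (by positivity) (by positivity), Real.mul_rpow (by positivity) hV.le,
      ← Real.rpow_mul hR.le, mul_comm (R ^ _)] at h1
    have h2 : q * (p - 1) = p := by
      have := hpq.sub_one_mul_conj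
      linarith
    rwa [h2] at h1
  · have h1 := Real.rpow_le_rpow (by positivity) hlo hp0.le
    have h2 : (1 - 1 / p) * p = p - 1 := by field_simp
    rw [Real.mul_rpow hV.le (by positivity),
      Real.mul_rpow (x := I ^ (1 - 1 / p)) (by positivity) (by positivity), ← Real.rpow_mul hI0,
      ← Real.rpow_mul (by positivity), one_div_mul_cancel hp0.ne', Real.rpow_one, h2,
      Real.div_rpow hq.le (by positivity),
      Real.div_rpow hq.le hR.le] at h1
    have hVp : V ^ p = V ^ (p - 1) * V := by
      rw [← Real.rpow_add_one hV.ne']; congr 1; ring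
    have hqp : (q + 2) ^ p = (q + 2) ^ (p - 1) * (q + 2) := by
      rw [← Real.rpow_add_one (by positivity)]; congr 1; ring
    rw [hVp, hqp] at h1
    have a1 : 0 < q ^ p := by positivity
    have a2 : 0 < (q + 2) ^ (p - 1) := by positivity
    have a3 : 0 < R ^ p := by positivity
    have a4 : 0 < V ^ (p - 1) := by positivity
    have a5 : 0 < I ^ (p - 1) := by positivity
    -- Both sides of the `p`-th power of the lower bound share the positive factor written last,
    -- which is cancelled.
    have h3 : V ^ (p - 1) * V * (q ^ p / ((q + 2) ^ (p - 1) * (q + 2))) =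
        (V ^ (p - 1) * R ^ p) * (V * q ^ p / (R ^ p * (q + 2) * (q + 2) ^ (p - 1))) := by
      field_simp
    have h4 : I ^ (p - 1) * (q ^ p / R ^ p * (V * (2 / (q + 2)))) =
        (2 * (q + 2) ^ (p - 1) * I ^ (p - 1)) *
          (V * q ^ p / (R ^ p * (q + 2) * (q + 2) ^ (p - 1))) := by
      field_simp
    rw [h3, h4] at h1
    exact le_of_mul_le_mul_right h1 (by positivity)

theorem IsCircumscribed.Q_bounds (h : IsCircumscribed T n c R) (hR : inradius T = R) {p : ℝ}
    (hp : 1 < p) : 1 ≤ Q p T ∧ Q p T < 2 := by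
  obtain ⟨hI, hup, hlo⟩ := h.torsionalRigidity_bounds hp
  have hpq := Real.HolderConjugate.conjExponent hp
  have hp1 : 0 < p - 1 := by linarith
  have hp0 := hpq.pos
  have e1 : (2 * p - 1) / (p - 1) = p.conjExponent + 1 := by
    rw [Real.conjExponent]; field_simp; ring
  rw [Q, normalizedRigidity, hR, e1]
  set I := torsionalRigidity p T
  have hq := hpq.symm.lt
  set q := p.conjExponent
  have hRpos := h.pos
  have hV := h.volume_pos
  set V := volume.real T
  have e2 : I ^ (1 - p) = (I ^ (p - 1))⁻¹ := by rw [← Real.rpow_neg hI.le]; congr 1; ring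
  have a1 : 0 < I ^ (p - 1) := by positivity
  have a2 : 0 < (q + 1) ^ (p - 1) := by positivity
  rw [e2]
  have e3 : V ^ (p - 1) * (I ^ (p - 1))⁻¹ * R ^ p / (q + 1) ^ (p - 1) =
      V ^ (p - 1) * R ^ p / (I ^ (p - 1) * (q + 1) ^ (p - 1)) := by field_simp
  rw [e3]
  constructor
  · refine Real.one_le_rpow ?_ (by positivity)
    rw [one_le_div (by positivity)]
    rwa [le_div_iff₀ a2] at hup
  · have h2 : V ^ (p - 1) * R ^ p / (I ^ (p - 1) * (q + 1) ^ (p - 1)) < 2 ^ p := by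
      rw [div_lt_iff₀ (by positivity)]
      refine hlo.trans_lt ?_
      have h3 : (q + 2) ^ (p - 1) < 2 ^ (p - 1) * (q + 1) ^ (p - 1) := by
        rw [← Real.mul_rpow (by norm_num) (by positivity)]
        exact Real.rpow_lt_rpow (by positivity) (by linarith) hp1
      have h4 : (2 : ℝ) ^ p = 2 ^ (p - 1) * 2 := by
        rw [← Real.rpow_add_one (by norm_num)]; congr 1; ring
      rw [h4]
      nlinarith [mul_lt_mul_of_pos_right h3 a1]
    have h5 := Real.rpow_lt_rpow (by positivity) h2 (show 0 < 1 / p by positivity)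
    rwa [← Real.rpow_mul (by norm_num), mul_one_div_cancel hp0.ne', Real.rpow_one] at h5

end Bounds

/-! ### The inradius of a circumscribed polygon -/

section Inradius

variable {ι : Type*} {T : Set (EuclideanSpace ℝ (Fin 2))}
  {n : ι → EuclideanSpace ℝ (Fin 2)} {c : EuclideanSpace ℝ (Fin 2)} {R : ℝ}

/-- From any centre `x` some normal satisfies `⟨n i, x - c⟩ ≥ 0`; moving along it leaves `T` within
distance `R`, so no larger disc fits. -/
theorem IsCircumscribed.inradius_eq (h : IsCircumscribed T n c R) : inradius T = R := by
  refine IsGreatest.csSup_eq ⟨⟨h.pos.le, c, fun x hx => (h.mem_iff x).2 fun i => ?_⟩, ?_⟩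
  · have := real_inner_le_norm (n i) (x - c)
    rw [h.norm_eq, one_mul] at this
    exact this.trans_lt (mem_ball_iff_norm.1 hx)
  · rintro r ⟨-, x, hx⟩
    obtain ⟨i, hi⟩ := h.balanced (x - c)
    refine le_of_forall_lt fun s hs => ?_
    rcases lt_or_ge s 0 with h0 | h0
    · exact h0.trans h.pos
    have hmem : x + s • n i ∈ Metric.ball x r := by
      rw [mem_ball_iff_norm, add_sub_cancel_left, norm_smul, h.norm_eq, mul_one,
        Real.norm_of_nonneg h0]
      exact hs
    have h1 := (h.mem_iff _).1 (hx hmem) i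
    rw [add_sub_right_comm, inner_add_right, inner_smul_right, real_inner_self_eq_norm_sq,
      h.norm_eq] at h1
    linarith

end Inradius

/-! ### Plane determinants -/

section Cross

/-- The determinant of two plane vectors. -/
def cross (v w : EuclideanSpace ℝ (Fin 2)) : ℝ := v 0 * w 1 - v 1 * w 0

/-- Clockwise rotation by a right angle. -/
def rotate (v : EuclideanSpace ℝ (Fin 2)) : EuclideanSpace ℝ (Fin 2) := !₂[v 1, -v 0]

theorem inner_rotate (v w : EuclideanSpace ℝ (Fin 2)) : inner ℝ (rotate v) w = -cross v w := by
  simp [rotate, cross, PiLp.inner_apply, Fin.sum_univ_two]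
  ring

theorem norm_rotate (v : EuclideanSpace ℝ (Fin 2)) : ‖rotate v‖ = ‖v‖ := by
  rw [EuclideanSpace.norm_eq, EuclideanSpace.norm_eq]
  simp [rotate, Fin.sum_univ_two, add_comm]

/-- A barycentric coordinate is a ratio of signed areas. -/
theorem cross_combination (v : Fin 3 → EuclideanSpace ℝ (Fin 2)) (w : Fin 3 → ℝ)
    (hw : ∑ i, w i = 1) (i : Fin 3) :
    cross (v (i + 2) - v (i + 1)) (∑ j, w j • v j - v (i + 1)) =
      w i * cross (v 1 - v 0) (v 2 - v 0) := by
  have hw0 : w 0 = 1 - w 1 - w 2 := by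
    rw [Fin.sum_univ_three] at hw
    linarith
  fin_cases i <;> simp [cross, Fin.sum_univ_three, hw0] <;> ring

theorem cross_sides (v : Fin 3 → EuclideanSpace ℝ (Fin 2)) (i : Fin 3) :
    cross (v (i + 2) - v (i + 1)) (v (i + 1 + 2) - v (i + 1 + 1)) =
      cross (v 1 - v 0) (v 2 - v 0) := by
  fin_cases i <;> simp [cross] <;> ring

theorem sum_sides (v : Fin 3 → EuclideanSpace ℝ (Fin 2)) :
    ∑ i : Fin 3, (v (i + 2) - v (i + 1)) = 0 := by
  simp [Fin.sum_univ_three]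
  abel

end Cross

/-! ### Triangles: incircle, perimeter and area -/

section Triangle

variable (B : AffineBasis (Fin 3) ℝ (EuclideanSpace ℝ (Fin 2)))

/-- The side of a triangle opposite to the `i`-th vertex, as a vector. -/
def sideVector (i : Fin 3) : EuclideanSpace ℝ (Fin 2) := B (i + 2) - B (i + 1)

/-- Twice the signed area of a triangle. -/
def doubleArea : ℝ := cross (B 1 - B 0) (B 2 - B 0)

theorem cross_sideVector (i : Fin 3) (x : EuclideanSpace ℝ (Fin 2)) :
    cross (sideVector B i) (x - B (i + 1)) = B.coord i x * doubleArea B := by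
  have := cross_combination B (fun j => B.coord j x) (B.sum_coord_apply_eq_one x) i
  rwa [B.linear_combination_coord_eq_self] at this

theorem sideVector_ne_zero (i : Fin 3) : sideVector B i ≠ 0 := by
  rw [sideVector, sub_ne_zero]
  intro h
  have := B.ind.injective h
  simp at this

theorem doubleArea_ne_zero : doubleArea B ≠ 0 := by
  intro h
  refine sideVector_ne_zero B 0 ?_
  have h1 : ∀ y, cross (sideVector B 0) y = 0 := fun y => by
    have := cross_sideVector B 0 (y + B (0 + 1))
    rwa [add_sub_cancel_right, h, mul_zero] at this
  have h2 : inner ℝ (rotate (sideVector B 0)) (rotate (sideVector B 0)) = (0 : ℝ) := by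
    rw [inner_rotate, h1, neg_zero]
  rw [real_inner_self_eq_norm_sq, norm_rotate] at h2
  simpa using h2

/-- The sum of the side lengths. -/
def sideSum : ℝ := ∑ i, ‖sideVector B i‖

theorem norm_sideVector_pos (i : Fin 3) : 0 < ‖sideVector B i‖ :=
  norm_pos_iff.2 (sideVector_ne_zero B i)

theorem sideSum_pos : 0 < sideSum B :=
  Finset.sum_pos (fun i _ => norm_sideVector_pos B i) Finset.univ_nonempty

/-- Positive orientation makes clockwise rotated sides point outwards. A point with `i`-th
barycentric coordinate `w` has signed distance `w * doubleArea B / ‖sideVector B i‖` from side `i`;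
weights proportional to the side lengths make the three distances equal. -/
theorem isCircumscribed_triangle (hD : 0 < doubleArea B) :
    IsCircumscribed (interior (convexHull ℝ (range B)))
      (fun i => ‖sideVector B i‖⁻¹ • rotate (sideVector B i))
      (∑ i, (‖sideVector B i‖ / sideSum B) • B i) (doubleArea B / sideSum B) := by
  have hP := sideSum_pos B
  have hl := norm_sideVector_pos B
  have hneg : ∀ i y, inner ℝ (‖sideVector B i‖⁻¹ • rotate (sideVector B i)) y =
      -(cross (sideVector B i) y / ‖sideVector B i‖) := fun i y => by
    rw [real_inner_smul_left, inner_rotate]; ring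
  have hcross : ∀ i j, i ≠ j → cross (sideVector B i) (sideVector B j) ≠ 0 := by
    have h1 : ∀ i, cross (sideVector B i) (sideVector B (i + 1)) ≠ 0 := fun i => by
      have := cross_sides B i
      rw [sideVector, sideVector, this]
      exact hD.ne'
    have hswap : ∀ v w, cross v w = -cross w v := fun v w => by simp only [cross]; ring
    intro i j hij
    have : j = i + 1 ∨ i = j + 1 := by revert i j; decide
    rcases this with rfl | rfl
    · exact h1 i
    · rw [hswap, neg_ne_zero]; exact h1 j
  refine ⟨div_pos hD hP, fun i => ?_, fun i j hij => ?_, fun y => ?_, fun x => ?_, ?_⟩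
  · rw [norm_smul, norm_rotate, norm_inv, norm_norm, inv_mul_cancel₀ (hl i).ne']
  · by_contra hne
    have h1 := hneg i (sideVector B j)
    have hself : cross (sideVector B j) (sideVector B j) = 0 := by simp only [cross]; ring
    rw [hij, hneg, hself, zero_div, neg_zero, eq_comm, neg_eq_zero, div_eq_zero_iff] at h1
    exact h1.elim (hcross i j hne) (hl i).ne'
  -- The sides sum to zero, so their determinants with `y` cannot all be positive.
  · by_contra! hc
    have h1 : ∀ i, 0 < cross (sideVector B i) y := fun i => by
      have := hc i
      rw [hneg, neg_lt_zero] at this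
      exact (div_pos_iff_of_pos_right (hl i)).1 this
    have h2 : ∑ i, cross (sideVector B i) y = 0 := by
      have := sum_sides B
      have h3 : ∀ k : Fin 2, ∑ i, sideVector B i k = 0 := fun k => by
        have := congrArg (fun v : EuclideanSpace ℝ (Fin 2) => v k) this
        simpa [sideVector] using this
      simp only [cross, Finset.sum_sub_distrib, ← Finset.sum_mul, h3]
      ring
    have h3 := Finset.sum_pos (fun i (_ : i ∈ Finset.univ) => h1 i) Finset.univ_nonempty
    linarith
  · rw [B.interior_convexHull, mem_ofPred_eq]
    refine forall_congr' fun i => ?_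
    have hw : ∑ i, ‖sideVector B i‖ / sideSum B = 1 := by
      rw [← Finset.sum_div]; exact div_self hP.ne'
    have h1 := cross_combination B (fun i => ‖sideVector B i‖ / sideSum B) hw i
    have h2 := cross_sideVector B i x
    set o := ∑ i, (‖sideVector B i‖ / sideSum B) • B i with ho
    have h3 : cross (sideVector B i) (x - o) =
        B.coord i x * doubleArea B - ‖sideVector B i‖ / sideSum B * doubleArea B := by
      rw [← h2]
      change _ = _ - ‖sideVector B i‖ / sideSum B * cross (B 1 - B 0) (B 2 - B 0)
      rw [← h1]
      simp only [cross, sideVector, PiLp.sub_apply]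
      ring
    rw [hneg, h3]
    have hli := hl i
    have h4 : -((B.coord i x * doubleArea B - ‖sideVector B i‖ / sideSum B * doubleArea B) /
        ‖sideVector B i‖) = doubleArea B / sideSum B -
          B.coord i x * (doubleArea B / ‖sideVector B i‖) := by
      field_simp
      ring
    rw [h4, sub_lt_self_iff]
    exact (mul_pos_iff_of_pos_right (by positivity)).symm
  · exact ((isBounded_convexHull).2 (finite_range B).isBounded).subset interior_subset

/-- The frontier consists of the faces where one barycentric coordinate vanishes. These are the
sides; two of them share at most one point, which is null for length. -/
theorem perimeter_triangle : perimeter (interior (convexHull ℝ (range B))) = sideSum B := by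
  set F : Fin 3 → Set (EuclideanSpace ℝ (Fin 2)) :=
    fun i => {x | (∀ j, 0 ≤ B.coord j x) ∧ B.coord i x = 0} with hF
  have hconv := convex_convexHull ℝ (range B)
  have hclosed : IsClosed (convexHull ℝ (range B)) := (finite_range B).isClosed_convexHull ℝ
  have hne : (interior (convexHull ℝ (range B))).Nonempty :=
    ⟨_, B.centroid_mem_interior_convexHull⟩
  have hfront : frontier (interior (convexHull ℝ (range B))) = ⋃ i, F i := by
    rw [frontier, interior_interior, hconv.closure_interior_eq_closure_of_nonempty_interior hne,
      hclosed.closure_eq, B.interior_convexHull, B.convexHull_eq_nonneg_coord]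
    ext x
    simp only [Set.mem_sdiff, mem_ofPred_eq, not_forall, not_lt, mem_iUnion, hF]
    constructor
    · rintro ⟨h1, i, hi⟩
      exact ⟨i, h1, le_antisymm hi (h1 i)⟩
    · rintro ⟨i, h1, hi⟩
      exact ⟨h1, i, hi.le⟩
  have hseg : ∀ i, F i = segment ℝ (B (i + 1)) (B (i + 2)) := by
    intro i
    have hsum : ∀ f : Fin 3 → ℝ, ∑ j, f j = f i + f (i + 1) + f (i + 2) := by
      intro f
      rw [Fin.sum_univ_three]
      fin_cases i <;> simp <;> ring
    have hcomb : ∀ f : Fin 3 → EuclideanSpace ℝ (Fin 2), ∑ j, f j = f i + f (i + 1) + f (i + 2) := by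
      intro f
      rw [Fin.sum_univ_three]
      fin_cases i <;> simp <;> abel
    ext x
    constructor
    · rintro ⟨h1, h2⟩
      refine ⟨B.coord (i + 1) x, B.coord (i + 2) x, h1 _, h1 _, ?_, ?_⟩
      · have := B.sum_coord_apply_eq_one x
        rw [hsum, h2, zero_add] at this
        exact this
      · have := B.linear_combination_coord_eq_self x
        rw [hcomb, h2, zero_smul, zero_add] at this
        exact this
    · rintro ⟨s, t, hs, ht, hst, rfl⟩
      have hc : ∀ j, B.coord j (s • B (i + 1) + t • B (i + 2)) =
          s * (if j = i + 1 then 1 else 0) + t * (if j = i + 2 then 1 else 0) := by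
        intro j
        rw [Convex.combo_affine_apply hst, B.coord_apply, B.coord_apply, smul_eq_mul, smul_eq_mul]
      refine ⟨fun j => ?_, ?_⟩
      · rw [hc]
        split_ifs <;> simp [hs, ht, add_nonneg]
      · rw [hc]; simp
  have hmeas : ∀ i, MeasurableSet (F i) := fun i => by
    have hcont := fun j => continuous_barycentric_coord B j
    have : F i = (⋂ j, {x | 0 ≤ B.coord j x}) ∩ {x | B.coord i x = 0} := by
      ext x; simp [hF]
    rw [this]
    exact ((isClosed_iInter fun j => isClosed_le continuous_const (hcont j)).inter
      (isClosed_eq (hcont i) continuous_const)).measurableSet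
  have hnull := Measure.nullSingletonClass_hausdorff (EuclideanSpace ℝ (Fin 2)) one_pos
  have hdisj : Pairwise (Function.onFun
      (AEDisjoint (Measure.hausdorffMeasure 1 : Measure (EuclideanSpace ℝ (Fin 2)))) F) := by
    intro i j hij
    refine Set.Subsingleton.measure_zero ?_ _
    rintro x ⟨hxi, hxj⟩ y ⟨hyi, hyj⟩
    have hx := B.sum_coord_apply_eq_one x
    have hy := B.sum_coord_apply_eq_one y
    obtain ⟨k, hk, hall⟩ : ∃ k : Fin 3, (∀ f : Fin 3 → ℝ, ∑ l, f l = f i + f j + f k) ∧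
        ∀ l, l = i ∨ l = j ∨ l = k := by
      fin_cases i <;> fin_cases j <;> first
        | exact absurd rfl hij
        | exact ⟨0, fun f => by rw [Fin.sum_univ_three]; simp; ring, by decide⟩
        | exact ⟨1, fun f => by rw [Fin.sum_univ_three]; simp; ring, by decide⟩
        | exact ⟨2, fun f => by rw [Fin.sum_univ_three]; simp; ring, by decide⟩
        | exact ⟨2, fun f => by rw [Fin.sum_univ_three]; simp, by decide⟩
    rw [hk, hxi.2, hxj.2] at hx
    rw [hk, hyi.2, hyj.2] at hy
    refine B.ext_elem fun l => ?_
    rcases hall l with rfl | rfl | rfl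
    · rw [hxi.2, hyi.2]
    · rw [hxj.2, hyj.2]
    · linarith
  rw [perimeter, hfront, Measure.real, measure_iUnion₀ hdisj fun i => (hmeas i).nullMeasurableSet,
    tsum_fintype, ENNReal.toReal_sum fun i _ => by rw [hseg, hausdorffMeasure_segment]; exact edist_ne_top _ _]
  refine Finset.sum_congr rfl fun i _ => ?_
  rw [hseg, hausdorffMeasure_segment, edist_comm, edist_dist, ENNReal.toReal_ofReal dist_nonneg,
    dist_eq_norm, sideVector]

theorem volume_standard_triangle :
    volume {z : Fin 2 → ℝ | 0 < z 0 ∧ 0 < z 1 ∧ z 0 + z 1 < 1} = ENNReal.ofReal (1 / 2) := by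
  have h1 := (volume_preserving_finTwoArrow ℝ).measure_preimage_equiv
    (regionBetween (fun _ => 0) (fun t => 1 - t) (Ioo (0 : ℝ) 1))
  have i1 : IntegrableOn (fun t : ℝ => 1 - t) (Ioo 0 1) :=
    ((by fun_prop : Continuous fun t : ℝ => 1 - t).integrableOn_Icc (a := 0) (b := 1)).mono_set
      Ioo_subset_Icc_self
  rw [Measure.volume_eq_prod, volume_regionBetween_eq_integral (by simp) i1 measurableSet_Ioo
    (fun x hx => by linarith [hx.2])] at h1
  have h2 : {z : Fin 2 → ℝ | 0 < z 0 ∧ 0 < z 1 ∧ z 0 + z 1 < 1} = MeasurableEquiv.finTwoArrow ⁻¹'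
      (regionBetween (fun _ => 0) (fun t => 1 - t) (Ioo (0 : ℝ) 1)) := by
    ext z
    simp only [mem_ofPred_eq, regionBetween, mem_preimage, mem_Ioo]
    change _ ↔ (0 < z 0 ∧ z 0 < 1) ∧ 0 < z 1 ∧ z 1 < 1 - z 0
    constructor
    · rintro ⟨h1, h2, h3⟩
      exact ⟨⟨h1, by linarith⟩, h2, by linarith⟩
    · rintro ⟨⟨h1, h2⟩, h3, h4⟩
      exact ⟨h1, h3, by linarith⟩
  rw [h2, h1]
  congr 1
  have : ((fun t : ℝ => 1 - t) - fun _ => 0) = fun t => 1 - t := by ext; simp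
  rw [this, ← integral_Ioc_eq_integral_Ioo, ← intervalIntegral.integral_of_le zero_le_one,
    intervalIntegral.integral_sub (by simp) (by simp)]
  simp
  norm_num

/-- The triangle is an affine image of the standard one, of area `1 / 2`, under a map of determinant
`doubleArea B`. -/
theorem volume_triangle (hD : 0 < doubleArea B) :
    volume.real (interior (convexHull ℝ (range B))) = doubleArea B / 2 := by
  set T := interior (convexHull ℝ (range B)) with hT
  set M : Matrix (Fin 2) (Fin 2) ℝ :=
    !![(B 1 - B 0) 0, (B 2 - B 0) 0; (B 1 - B 0) 1, (B 2 - B 0) 1] with hM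
  have hdet : LinearMap.det (Matrix.toLin' M) = doubleArea B := by
    rw [LinearMap.det_toLin', hM, Matrix.det_fin_two_of, doubleArea, cross]
    ring
  set e : (Fin 2 → ℝ) ≃ᵐ EuclideanSpace ℝ (Fin 2) :=
    (MeasurableEquiv.toLp 2 (Fin 2 → ℝ)).trans (MeasurableEquiv.addLeft (B 0)) with he
  have hem : MeasurePreserving e := (measurePreserving_add_left volume (B 0)).comp
    (EuclideanSpace.volume_preserving_symm_measurableEquiv_toLp (Fin 2)).symm
  have hpre : Matrix.toLin' M ⁻¹' (e ⁻¹' T) =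
      {z : Fin 2 → ℝ | 0 < z 0 ∧ 0 < z 1 ∧ z 0 + z 1 < 1} := by
    ext z
    have hw : ∑ i, (![1 - z 0 - z 1, z 0, z 1] : Fin 3 → ℝ) i = 1 := by
      simp [Fin.sum_univ_three]
      ring
    have hz : e (Matrix.toLin' M z) = ∑ i, (![1 - z 0 - z 1, z 0, z 1] : Fin 3 → ℝ) i • B i := by
      change B 0 + WithLp.toLp 2 (Matrix.toLin' M z) = _
      ext k
      fin_cases k <;>
      simp [hM, Matrix.toLin'_apply, dotProduct, Fin.sum_univ_two,
        Fin.sum_univ_three] <;> ring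
    have hc : ∀ i, B.coord i (e (Matrix.toLin' M z)) =
        (![1 - z 0 - z 1, z 0, z 1] : Fin 3 → ℝ) i := by
      intro i
      have h1 := cross_combination B _ hw i
      rw [← hz] at h1
      have h2 := cross_sideVector B i (e (Matrix.toLin' M z))
      exact mul_right_cancel₀ hD.ne' (h2.symm.trans h1)
    rw [mem_preimage, mem_preimage, hT, B.interior_convexHull, mem_ofPred_eq, mem_ofPred_eq]
    simp only [hc, Fin.forall_fin_succ]
    simp
    constructor
    · rintro ⟨h1, h2, h3⟩
      exact ⟨h2, h3, by linarith⟩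
    · rintro ⟨h1, h2, h3⟩
      exact ⟨by linarith, h1, h2⟩
  have key := Measure.addHaar_preimage_linearMap volume (f := Matrix.toLin' M)
    (by rw [hdet]; exact hD.ne') (e ⁻¹' T)
  rw [hpre, volume_standard_triangle, hdet, hem.measure_preimage_equiv] at key
  have k2 := congrArg ENNReal.toReal key
  rw [ENNReal.toReal_mul, ENNReal.toReal_ofReal (by norm_num), ENNReal.toReal_ofReal (abs_nonneg _),
    abs_of_pos (by positivity)] at k2
  rw [Measure.real]
  field_simp at k2
  linarith

end Triangle

/-- Exchanging two vertices reverses the sign of the area, so positive orientation may be assumed.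
-/
theorem exists_affineBasis_of_mem_triangles {T : Set (EuclideanSpace ℝ (Fin 2))}
    (hT : T ∈ triangles) : ∃ B : AffineBasis (Fin 3) ℝ (EuclideanSpace ℝ (Fin 2)),
      0 < doubleArea B ∧ T = interior (convexHull ℝ (range B)) := by
  obtain ⟨a, b, c, hind, rfl⟩ := hT
  have mk : ∀ v : Fin 3 → EuclideanSpace ℝ (Fin 2), AffineIndependent ℝ v →
      ∃ B : AffineBasis (Fin 3) ℝ (EuclideanSpace ℝ (Fin 2)), (B : Fin 3 → _) = v := fun v hv =>
    ⟨⟨v, hv, hv.affineSpan_eq_top_iff_card_eq_finrank_add_one.2 (by simp)⟩, rfl⟩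
  obtain ⟨B, hB⟩ := mk _ hind
  have hswap : AffineIndependent ℝ ![a, c, b] := by
    have := (affineIndependent_equiv (Equiv.swap (1 : Fin 3) 2)).2 hind
    convert this using 1
    ext i
    fin_cases i <;> simp [Equiv.swap_apply_def]
  obtain ⟨B', hB'⟩ := mk _ hswap
  have hrange : ∀ x y z : EuclideanSpace ℝ (Fin 2), range ![x, y, z] = {x, y, z} := by
    intro x y z
    ext w
    simp [eq_comm]
    tauto
  have hr : range B = {a, b, c} := by rw [hB, hrange]
  have hr' : range B' = {a, b, c} := by rw [hB', hrange, pair_comm]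
  have harea : doubleArea B' = -doubleArea B := by
    simp [doubleArea, hB, hB', cross]; ring
  rcases (doubleArea_ne_zero B).lt_or_gt with h | h
  · exact ⟨B', by linarith, by rw [hr']⟩
  · exact ⟨B, h, by rw [hr]⟩

theorem triangles_nonempty : triangles.Nonempty := by
  obtain ⟨B⟩ := AffineBasis.exists_affineBasis_of_finiteDimensional (ι := Fin 3) (k := ℝ)
    (P := EuclideanSpace ℝ (Fin 2)) (by simp)
  refine ⟨_, B 0, B 1, B 2, ?_, rfl⟩
  have : ![B 0, B 1, B 2] = B := by
    ext i
    fin_cases i <;> rfl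
  rw [this]
  exact B.ind

end PTorsion

end

/-! ### The proposition -/

theorem mainTheorem7 (p : ℝ) (hp : 1 < p) :
    (∀ T ∈ PTorsion.triangles,
      PTorsion.inradius T * PTorsion.perimeter T / volume.real T = 2) ∧
    (∀ T ∈ PTorsion.triangles, 1 ≤ PTorsion.Q p T ∧ PTorsion.Q p T < 2) ∧
    1 / 2 ≤ PTorsion.gamma PTorsion.triangles p := by
  have hQ : ∀ T ∈ PTorsion.triangles, 1 ≤ PTorsion.Q p T ∧ PTorsion.Q p T < 2 := by
    intro T hT
    obtain ⟨B, hD, rfl⟩ := PTorsion.exists_affineBasis_of_mem_triangles hT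
    have h := PTorsion.isCircumscribed_triangle B hD
    exact h.Q_bounds h.inradius_eq hp
  refine ⟨fun T hT => ?_, hQ, ?_⟩
  · obtain ⟨B, hD, rfl⟩ := PTorsion.exists_affineBasis_of_mem_triangles hT
    have hP := PTorsion.sideSum_pos B
    rw [(PTorsion.isCircumscribed_triangle B hD).inradius_eq, PTorsion.perimeter_triangle,
      PTorsion.volume_triangle B hD]
    field_simp
  · obtain ⟨T, hT⟩ := PTorsion.triangles_nonempty
    have hne : (PTorsion.Q p '' PTorsion.triangles).Nonempty := ⟨_, T, hT, rfl⟩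
    have hα : 1 ≤ PTorsion.alpha PTorsion.triangles p :=
      le_csInf hne (by rintro _ ⟨S, hS, rfl⟩; exact (hQ S hS).1)
    have hle : ∀ y ∈ PTorsion.Q p '' PTorsion.triangles, y ≤ 2 := by
      rintro _ ⟨S, hS, rfl⟩
      exact (hQ S hS).2.le
    have hβ : PTorsion.beta PTorsion.triangles p ≤ 2 := csSup_le hne hle
    -- Needed to make the denominator of `gamma` positive; `le_csSup` requires the upper bound `2`.
    have hβ1 : 1 ≤ PTorsion.beta PTorsion.triangles p :=
      (hQ T hT).1.trans (le_csSup ⟨2, hle⟩ ⟨T, hT, rfl⟩)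
    rw [PTorsion.gamma, div_le_div_iff₀ (by norm_num) (by linarith)]
    linarith
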